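/- Let $F,A\in\mathbb R^{m\times n}$, $H\in\mathbb R^{p\times n}$, let $Q_0,Q\in\mathbb R^{m\times m}$, $R\in\mathbb R^{p\times p}$ be symmetric positive definite, $\ell\in\mathbb R^m$, $t_1>0$, $I=[0,t_1]$. Elements of $L^2$ and $L^2_{loc}$ are taken up to equality a.e.; for such an $x$, "$Fx$ is absolutely continuous" means that $Fx$ has an absolutely continuous representative, and $Fx(t)$ denotes the value of that representative (likewise for $F^\top q$). $X^+$ denotes the Moore–Penrose pseudoinverse. *Observers.* An admissible solution on $I$ is a tuple $(x,f,y,\eta)$ of $L^2(I)$ functions such that $Fx$ is absolutely continuous, $Fx(t)=Fx(0)+\int_0^t(Ax+f)\,ds$ for all $t\in I$, $y=Hx+\eta$ a.e., and $(Fx(0))^\top Q_0Fx(0)+\int_0^{t}(f^\top Qf+\eta^\top R\eta)\,ds\le 1$ for all $t\in I$. For $U\in L^2(I,\mathbb R^p)$ put $\mathcal O_U(t_1,y)=\int_0^{t_1}y^\top(t)U(t)\,dt$ and $\sigma(U,\ell,t_1)=\sup(\ell^\top Fx(t_1)-\mathcal O_U(t_1,y))^2$, the supremum being over all admissible solutions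 on $I$. $\widehat U\in L^2(I,\mathbb R^p)$ is a finite horizon minimax observer on $I$ if $\sigma(\widehat U,\ell,t_1)=\inf_{U\in L^2(I,\mathbb R^p)}\sigma(U,\ell,t_1)<+\infty$. *Dual equation.* On an interval $I'$ of the form $[0,\tau]$, $\tau>0$, or $[0,\infty)$, a solution of the dual equation is a pair $(q,u)\in L^2_{loc}(I',\mathbb R^m)\times L^2_{loc}(I',\mathbb R^p)$ such that $F^\top q$ is absolutely continuous on compact intervals and $F^\top q(t)=F^\top q(0)+\int_0^t(A^\top q-H^\top u)\,ds$ for all $t\in I'$. $(F,A,H)$ is $\ell$-impulse observable if for some $\tau>0$ there is a solution of the dual equation on $[0,\tau]$ with $F^\top q(0)=F^\top\ell$. *Associated system.* Let $A_a\in\mathbb R^{\hat n\times\hat n}$, $B_a\in\mathbb R^{\hat n\times k}$, $C_a=\begin{bmatrix}C_s\\C_u\end{bmatrix}\in\mathbb R^{(m+p)\times\hat n}$, $D_a=\begin{bmatrix}D_s\\D_u\end{bmatrix}\in\mathbb R^{(m+p)\times k}$ ($C_s,D_s$ with $m$ rows, $C_u,D_u$ with $p$ rows) be an LTI system associated with the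 dual equation, i.e.: (1) either $k=1$, $D_a=0$, $B_a=0$, or $D_a$ has full column rank; (2) $F^\top D_s=0$ and $\mathrm{rank}\,F^\top C_s=\hat n$; (3) on every interval $I'$ as above, $(q,u)$ is a solution of the dual equation if and only if there are $v\in AC(I',\mathbb R^{\hat n})$ (absolutely continuous on compact intervals) and $g\in L^2_{loc}(I',\mathbb R^k)$ with $\dot v=A_av+B_ag$ a.e. and $\begin{bmatrix}q\\u\end{bmatrix}=C_av+D_ag$ a.e. Let $\mathcal M=(F^\top C_s)^+$. *Riccati equation.* Let $\Pi=\mathcal I_m-(F^\top)^+F^\top$, $\mathcal M_{opt}=\Pi(\Pi Q_0^{-1}\Pi)^+\Pi Q_0^{-1}(F^\top)^+$, $\bar Q_0=F((F^\top)^+-\mathcal M_{opt})^\top Q_0^{-1}((F^\top)^+-\mathcal M_{opt})F^\top$, $S=\mathrm{diag}(Q^{-1},R^{-1})$. Consider $$\dot P(t)=A_a^\top P(t)+P(t)A_a-K^\top(t)(D_a^\top SD_a)K(t)+C_a^\top SC_a,\qquad P(0)=C_s^\top\bar Q_0C_s,$$ where $K(t)=(D_a^\top SD_a)^{-1}(B_a^\top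 P(t)+D_a^\top SC_a)$ if $D_a\ne0$ and $K(t)=0$ if $D_a=0$. **Theorem.** Suppose that $(F,A,H)$ is $\ell$-impulse observable. The Riccati equation has a solution on $[0,t_1]$; let $P$ be any solution on $[0,t_1]$ and $K$ the corresponding gain. There is $v\in AC(I,\mathbb R^{\hat n})$ with $\dot v(s)=(A_a-B_aK(t_1-s))v(s)$ a.e., $v(0)=\mathcal M F^\top\ell$; for any such $v$ put $u^*(s)=(C_u-D_uK(t_1-s))v(s)$. Then $\widehat U(s)=u^*(t_1-s)$ is a finite horizon minimax observer on $I=[0,t_1]$, and $$\sigma(\widehat U,\ell,t_1)=\ell^\top F\mathcal M^\top P(t_1)\mathcal M F^\top\ell .$$ Moreover, for every $y\in L^2(I,\mathbb R^p)$ there is $r\in AC(I,\mathbb R^{\hat n})$ with $r(0)=0$ and $$\dot r(t)=(A_a-B_aK(t))^\top r(t)+(C_u-D_uK(t))^\top y(t)\quad\text{a.e.},$$ and every such $r$ satisfies $\mathcal O_{\widehat U}(t_1,y)=\ell^\top F\mathcal M^\top r(t_1)$. -/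

import Mathlib

open Set MeasureTheory Matrix

/-! ### Moore-Penrose pseudoinverse of a real matrix -/

/-- `X` satisfies the four Penrose equations for `A`. -/
structure IsPinv {ι κ : Type*} [Fintype ι] [Fintype κ]
    (A : Matrix ι κ ℝ) (X : Matrix κ ι ℝ) : Prop where
  mul_mul : A * X * A = A
  mul_mul' : X * A * X = X
  symm_left : (A * X)ᵀ = A * X
  symm_right : (X * A)ᵀ = X * A

theorem IsPinv.unique {ι κ : Type*} [Fintype ι] [Fintype κ]
    {A : Matrix ι κ ℝ} {X Y : Matrix κ ι ℝ} (hX : IsPinv A X) (hY : IsPinv A Y) : X = Y := by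
  have h1 : A * X = A * Y := by
    calc A * X = (A * X)ᵀ := hX.symm_left.symm
      _ = ((A * Y) * (A * X))ᵀ := by rw [← Matrix.mul_assoc, hY.mul_mul]
      _ = (A * X) * (A * Y) := by rw [transpose_mul, hX.symm_left, hY.symm_left]
      _ = A * Y := by rw [← Matrix.mul_assoc, hX.mul_mul]
  have h2 : X * A = Y * A := by
    calc X * A = (X * A)ᵀ := hX.symm_right.symm
      _ = ((X * A) * (Y * A))ᵀ := by
        rw [Matrix.mul_assoc X A (Y * A), ← Matrix.mul_assoc A Y A, hY.mul_mul]
      _ = (Y * A) * (X * A) := by rw [transpose_mul, hX.symm_right, hY.symm_right]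
      _ = Y * A := by rw [Matrix.mul_assoc Y A (X * A), ← Matrix.mul_assoc A X A, hX.mul_mul]
  calc X = X * A * X := hX.mul_mul'.symm
    _ = Y * (A * X) := by rw [h2, Matrix.mul_assoc]
    _ = Y * A * Y := by rw [h1, Matrix.mul_assoc]
    _ = Y := hY.mul_mul'

theorem exists_isPinv_of_symm {κ : Type*} [Fintype κ] (B : Matrix κ κ ℝ) (hB : B.IsHermitian) :
    ∃ X : Matrix κ κ ℝ, B * X * B = B ∧ X * B * X = X ∧ Xᵀ = X ∧ X * B = B * X := by
  classical
  obtain ⟨U, e, hUU, hspec⟩ : ∃ (U : Matrix κ κ ℝ) (e : κ → ℝ),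
      Uᵀ * U = 1 ∧ B = U * diagonal e * Uᵀ := by
    refine ⟨(hB.eigenvectorUnitary : Matrix κ κ ℝ), hB.eigenvalues, ?_, ?_⟩
    · have := Unitary.coe_star_mul_self hB.eigenvectorUnitary
      rwa [star_eq_conjTranspose, conjTranspose_eq_transpose_of_trivial] at this
    · have := hB.spectral_theorem
      rw [Unitary.conjStarAlgAut_apply, star_eq_conjTranspose,
        conjTranspose_eq_transpose_of_trivial] at this
      simpa using this
  have key : ∀ a b : κ → ℝ, (U * diagonal a * Uᵀ) * (U * diagonal b * Uᵀ)
      = U * diagonal (fun i => a i * b i) * Uᵀ := by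
    intro a b
    calc _ = U * diagonal a * (Uᵀ * U) * diagonal b * Uᵀ := by simp only [Matrix.mul_assoc]
      _ = _ := by rw [hUU, Matrix.mul_one, Matrix.mul_assoc U, diagonal_mul_diagonal]
  refine ⟨U * diagonal (fun i => (e i)⁻¹) * Uᵀ, ?_, ?_, ?_, ?_⟩
  · rw [hspec, key, key]
    congr 3; funext i; exact mul_inv_mul_cancel _
  · rw [hspec, key, key]
    congr 3; funext i
    simpa using mul_inv_mul_cancel (e i)⁻¹
  · simp [transpose_mul, Matrix.mul_assoc]
  · rw [hspec, key, key]
    congr 3; funext i; exact mul_comm _ _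

theorem exists_isPinv {ι κ : Type*} [Fintype ι] [Fintype κ] (A : Matrix ι κ ℝ) :
    ∃ X : Matrix κ ι ℝ, IsPinv A X := by
  classical
  have hB : (Aᵀ * A).IsHermitian := by
    simpa [conjTranspose_eq_transpose_of_trivial] using isHermitian_conjTranspose_mul_self A
  obtain ⟨Y, h1, h2, h3, h4⟩ := exists_isPinv_of_symm (Aᵀ * A) hB
  refine ⟨Y * Aᵀ, ?_, ?_, ?_, ?_⟩
  · rw [← sub_eq_zero, ← conjTranspose_mul_self_eq_zero, conjTranspose_eq_transpose_of_trivial]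
    have e : A * (Y * Aᵀ) * A - A = A * (Y * (Aᵀ * A) - 1) := by
      simp only [Matrix.mul_sub, Matrix.mul_assoc, Matrix.mul_one]
    have e2 : Aᵀ * A * (Y * (Aᵀ * A) - 1) = 0 := by
      rw [Matrix.mul_sub, ← Matrix.mul_assoc, h1, Matrix.mul_one, sub_self]
    rw [e, transpose_mul, Matrix.mul_assoc, ← Matrix.mul_assoc Aᵀ A, e2, Matrix.mul_zero]
  · calc Y * Aᵀ * A * (Y * Aᵀ) = (Y * (Aᵀ * A) * Y) * Aᵀ := by simp only [Matrix.mul_assoc]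
      _ = Y * Aᵀ := by rw [h2]
  · simp [transpose_mul, h3, Matrix.mul_assoc]
  · rw [Matrix.mul_assoc, transpose_mul, h3, h4, transpose_mul, transpose_transpose]

/-- The Moore-Penrose pseudoinverse `A⁺`. -/
noncomputable def pinv {ι κ : Type*} [Fintype ι] [Fintype κ] (A : Matrix ι κ ℝ) :
    Matrix κ ι ℝ :=
  (exists_isPinv A).choose

theorem pinv_spec {ι κ : Type*} [Fintype ι] [Fintype κ] (A : Matrix ι κ ℝ) :
    IsPinv A (pinv A) :=
  (exists_isPinv A).choose_spec

/-! ### Time intervals and function spaces -/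

/-- The intervals `[0, t₁]`, `t₁ > 0`, and `[0, ∞)`. -/
def IsTimeInterval (I : Set ℝ) : Prop :=
  (∃ t₁ : ℝ, 0 < t₁ ∧ I = Icc 0 t₁) ∨ I = Ici 0

/-- `f ∈ L²_loc(I, ℝᵈ)`: square integrable on every compact interval contained in `I`
(for `I = [0, t₁]` this is `L²(I, ℝᵈ)`). Elements are handled up to equality a.e. -/
def L2Loc {d : ℕ} (I : Set ℝ) (f : ℝ → Fin d → ℝ) : Prop :=
  ∀ a b : ℝ, Icc a b ⊆ I → MemLp f 2 (volume.restrict (Icc a b))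

/-- `f ∈ AC(I, ℝᵈ)`: absolutely continuous on every compact interval contained in `I`. -/
def ACOn {d : ℕ} (I : Set ℝ) (f : ℝ → Fin d → ℝ) : Prop :=
  ∀ a b : ℝ, a ≤ b → Icc a b ⊆ I → AbsolutelyContinuousOnInterval f a b

/-! ### Differential-algebraic equations -/

/-- `(x, f)` solves `d(Fx)/dt = A x + f` on `I`. As `x` is an element of `L²_loc`, that is, is
given up to null sets, `Fx` is absolutely continuous in the sense that it agrees a.e. with an
absolutely continuous function; this representative of `Fx` (it is unique on `I`) is `z`, and the
values `Fx(t)`, `t ∈ I`, are the values `z t`. -/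
structure IsDAESolution {m n : ℕ} (F A : Matrix (Fin m) (Fin n) ℝ) (I : Set ℝ)
    (x : ℝ → Fin n → ℝ) (f : ℝ → Fin m → ℝ) (z : ℝ → Fin m → ℝ) : Prop where
  x_mem : L2Loc I x
  f_mem : L2Loc I f
  ac : ACOn I z
  ae_eq : ∀ᵐ t ∂volume.restrict I, z t = F *ᵥ x t
  eqn : ∀ t ∈ I, z t = z 0 + ∫ s in (0 : ℝ)..t, (A *ᵥ x s + f s)

/-- `(x, f, y, η) ∈ 𝓑_I(F, A, H)`: solution of `d(Fx)/dt = A x + f`, `y = H x + η` on `I`;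
`z` is the continuous representative of `Fx`. -/
structure IsSolution {m n p : ℕ} (F A : Matrix (Fin m) (Fin n) ℝ) (H : Matrix (Fin p) (Fin n) ℝ)
    (I : Set ℝ) (x : ℝ → Fin n → ℝ) (f : ℝ → Fin m → ℝ) (y η : ℝ → Fin p → ℝ)
    (z : ℝ → Fin m → ℝ) : Prop where
  dae : IsDAESolution F A I x f z
  y_mem : L2Loc I y
  η_mem : L2Loc I η
  output : ∀ᵐ t ∂volume.restrict I, y t = H *ᵥ x t + η t

/-- `ρ(g₀, g, h, τ, S₀, S₁, S₂) = g₀ᵀ S₀ g₀ + ∫₀^τ (gᵀ S₁ g + hᵀ S₂ h) dt`. -/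
noncomputable def rho {m p : ℕ} (g₀ : Fin m → ℝ) (g : ℝ → Fin m → ℝ) (h : ℝ → Fin p → ℝ) (τ : ℝ)
    (S₀ S₁ : Matrix (Fin m) (Fin m) ℝ) (S₂ : Matrix (Fin p) (Fin p) ℝ) : ℝ :=
  g₀ ⬝ᵥ (S₀ *ᵥ g₀) + ∫ t in (0 : ℝ)..τ, (g t ⬝ᵥ (S₁ *ᵥ g t) + h t ⬝ᵥ (S₂ *ᵥ h t))

/-- Admissible solutions on `I`: `ρ(Fx(0), f, η, t, Q₀, Q, R) ≤ 1` for all `t ∈ I`. -/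
structure IsAdmissible {m n p : ℕ} (F A : Matrix (Fin m) (Fin n) ℝ)
    (H : Matrix (Fin p) (Fin n) ℝ) (Q₀ Q : Matrix (Fin m) (Fin m) ℝ)
    (R : Matrix (Fin p) (Fin p) ℝ) (I : Set ℝ)
    (x : ℝ → Fin n → ℝ) (f : ℝ → Fin m → ℝ) (y η : ℝ → Fin p → ℝ)
    (z : ℝ → Fin m → ℝ) : Prop where
  sol : IsSolution F A H I x f y η z
  bound : ∀ t ∈ I, rho (z 0) f η t Q₀ Q R ≤ 1

/-! ### Observers -/

/-- The estimate `∫₀^{t₁} yᵀ(t) U(t) dt` that the observer `U` computes from the output `y`. -/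
noncomputable def observerOutput {p : ℕ} (U y : ℝ → Fin p → ℝ) (t₁ : ℝ) : ℝ :=
  ∫ t in (0 : ℝ)..t₁, y t ⬝ᵥ U t

/-- The worst-case error `σ(U, ℓ, t₁)`: the supremum over all admissible solutions on `[0, t₁]` of
`(ℓᵀ F x(t₁) - ∫₀^{t₁} yᵀ U dt)²`, an extended real number. -/
noncomputable def worstCaseError {m n p : ℕ} (F A : Matrix (Fin m) (Fin n) ℝ)
    (H : Matrix (Fin p) (Fin n) ℝ) (Q₀ Q : Matrix (Fin m) (Fin m) ℝ)
    (R : Matrix (Fin p) (Fin p) ℝ) (ℓ : Fin m → ℝ) (t₁ : ℝ) (U : ℝ → Fin p → ℝ) : EReal :=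
  sSup {e : EReal | ∃ (x : ℝ → Fin n → ℝ) (f : ℝ → Fin m → ℝ) (y η : ℝ → Fin p → ℝ)
    (z : ℝ → Fin m → ℝ), IsAdmissible F A H Q₀ Q R (Icc 0 t₁) x f y η z ∧
      e = (((ℓ ⬝ᵥ z t₁ - observerOutput U y t₁) ^ 2 : ℝ) : EReal)}

/-- `U ∈ L²([0, t₁], ℝᵖ)` is a (finite horizon) minimax observer on `[0, t₁]`:
`σ(U, ℓ, t₁) = inf {σ(V, ℓ, t₁) | V ∈ L²([0, t₁], ℝᵖ)} < +∞`. -/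
structure IsMinimaxObserver {m n p : ℕ} (F A : Matrix (Fin m) (Fin n) ℝ)
    (H : Matrix (Fin p) (Fin n) ℝ) (Q₀ Q : Matrix (Fin m) (Fin m) ℝ)
    (R : Matrix (Fin p) (Fin p) ℝ) (ℓ : Fin m → ℝ) (t₁ : ℝ) (U : ℝ → Fin p → ℝ) : Prop where
  mem : L2Loc (Icc 0 t₁) U
  eq_inf : worstCaseError F A H Q₀ Q R ℓ t₁ U =
    sInf {e : EReal | ∃ V : ℝ → Fin p → ℝ, L2Loc (Icc 0 t₁) V ∧
      e = worstCaseError F A H Q₀ Q R ℓ t₁ V}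
  lt_top : worstCaseError F A H Q₀ Q R ℓ t₁ U < ⊤

/-! ### The dual equation -/

/-- `(q, u)` solves the dual equation `d(Fᵀq)/dt = Aᵀ q - Hᵀ u` on `I`, with `w` the continuous
representative of `Fᵀ q`. -/
structure IsDualSolution {m n p : ℕ} (F A : Matrix (Fin m) (Fin n) ℝ)
    (H : Matrix (Fin p) (Fin n) ℝ) (I : Set ℝ) (q : ℝ → Fin m → ℝ) (u : ℝ → Fin p → ℝ)
    (w : ℝ → Fin n → ℝ) : Prop where
  u_mem : L2Loc I u
  dae : IsDAESolution Fᵀ Aᵀ I q (fun t => -(Hᵀ *ᵥ u t)) w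

/-- `(F, A, H)` is `ℓ`-impulse observable: for some `t₁ > 0` the dual equation has a solution on
`[0, t₁]` with `Fᵀ q(0) = Fᵀ ℓ`. -/
def IsImpulseObservable {m n p : ℕ} (F A : Matrix (Fin m) (Fin n) ℝ)
    (H : Matrix (Fin p) (Fin n) ℝ) (ℓ : Fin m → ℝ) : Prop :=
  ∃ t₁ : ℝ, 0 < t₁ ∧ ∃ (q : ℝ → Fin m → ℝ) (u : ℝ → Fin p → ℝ) (w : ℝ → Fin n → ℝ),
    IsDualSolution F A H (Icc 0 t₁) q u w ∧ w 0 = Fᵀ *ᵥ ℓ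

/-! ### Associated linear systems -/

/-- A linear time invariant system `ẋ = A x + B g`, `(q, u) = C x + D g` with state space `ℝʳ`,
input space `ℝᵏ` and output space `ℝᵐ × ℝᵖ`. -/
structure LTI (m p r k : ℕ) where
  A : Matrix (Fin r) (Fin r) ℝ
  B : Matrix (Fin r) (Fin k) ℝ
  C : Matrix (Fin m ⊕ Fin p) (Fin r) ℝ
  D : Matrix (Fin m ⊕ Fin p) (Fin k) ℝ

namespace LTI

/-- First `m` rows of `C`. -/
def Cs {m p r k : ℕ} (S : LTI m p r k) : Matrix (Fin m) (Fin r) ℝ := S.C.toRows₁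

/-- Last `p` rows of `C`. -/
def Cu {m p r k : ℕ} (S : LTI m p r k) : Matrix (Fin p) (Fin r) ℝ := S.C.toRows₂

/-- First `m` rows of `D`. -/
def Ds {m p r k : ℕ} (S : LTI m p r k) : Matrix (Fin m) (Fin k) ℝ := S.D.toRows₁

/-- Last `p` rows of `D`. -/
def Du {m p r k : ℕ} (S : LTI m p r k) : Matrix (Fin p) (Fin k) ℝ := S.D.toRows₂

/-- The linear system `S` is associated with the dual equation `d(Fᵀq)/dt = Aᵀ q - Hᵀ u`. -/
structure IsAssociated {m n p r k : ℕ} (S : LTI m p r k) (F A : Matrix (Fin m) (Fin n) ℝ)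
    (H : Matrix (Fin p) (Fin n) ℝ) : Prop where
  input : (k = 1 ∧ S.D = 0 ∧ S.B = 0) ∨ S.D.rank = k
  Ds_eq : Fᵀ * S.Ds = 0
  rank_eq : (Fᵀ * S.Cs).rank = r
  behavior : ∀ I : Set ℝ, IsTimeInterval I →
    ∀ (q : ℝ → Fin m → ℝ) (u : ℝ → Fin p → ℝ),
      (∃ w : ℝ → Fin n → ℝ, IsDualSolution F A H I q u w) ↔
      ∃ (v : ℝ → Fin r → ℝ) (g : ℝ → Fin k → ℝ), ACOn I v ∧ L2Loc I g ∧
        (∀ᵐ t ∂volume.restrict I, HasDerivAt v (S.A *ᵥ v t + S.B *ᵥ g t) t) ∧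
        (∀ᵐ t ∂volume.restrict I, Sum.elim (q t) (u t) = S.C *ᵥ v t + S.D *ᵥ g t)

/-- The state map `𝓜 = (Fᵀ C_s)⁺`. -/
noncomputable def stateMap {m n p r k : ℕ} (S : LTI m p r k) (F : Matrix (Fin m) (Fin n) ℝ) :
    Matrix (Fin r) (Fin n) ℝ :=
  pinv (Fᵀ * S.Cs)

end LTI

/-! ### The Riccati equation -/

/-- `𝒫 = I - (Fᵀ)⁺ Fᵀ`, the orthogonal projection of `ℝᵐ` onto `ker Fᵀ`. -/
noncomputable def kerProj {m n : ℕ} (F : Matrix (Fin m) (Fin n) ℝ) : Matrix (Fin m) (Fin m) ℝ :=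
  1 - pinv Fᵀ * Fᵀ

/-- `M_opt = 𝒫 (𝒫 Q₀⁻¹ 𝒫)⁺ 𝒫 Q₀⁻¹ (Fᵀ)⁺`. -/
noncomputable def Mopt {m n : ℕ} (F : Matrix (Fin m) (Fin n) ℝ) (Q₀ : Matrix (Fin m) (Fin m) ℝ) :
    Matrix (Fin m) (Fin n) ℝ :=
  kerProj F * pinv (kerProj F * Q₀⁻¹ * kerProj F) * kerProj F * Q₀⁻¹ * pinv Fᵀ

/-- `Q̄₀ = F ((Fᵀ)⁺ - M_opt)ᵀ Q₀⁻¹ ((Fᵀ)⁺ - M_opt) Fᵀ`. -/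
noncomputable def Qbar {m n : ℕ} (F : Matrix (Fin m) (Fin n) ℝ) (Q₀ : Matrix (Fin m) (Fin m) ℝ) :
    Matrix (Fin m) (Fin m) ℝ :=
  F * (pinv Fᵀ - Mopt F Q₀)ᵀ * Q₀⁻¹ * (pinv Fᵀ - Mopt F Q₀) * Fᵀ

/-- The weight `diag(Q⁻¹, R⁻¹)` of `(q, u)`. -/
noncomputable def weight {m p : ℕ} (Q : Matrix (Fin m) (Fin m) ℝ) (R : Matrix (Fin p) (Fin p) ℝ) :
    Matrix (Fin m ⊕ Fin p) (Fin m ⊕ Fin p) ℝ :=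
  Matrix.fromBlocks Q⁻¹ 0 0 R⁻¹

open Classical in
/-- The gain that belongs to the value `P` of the Riccati solution:
`(Dᵀ W D)⁻¹ (Bᵀ P + Dᵀ W C)` if `D ≠ 0`, and `0` if `D = 0`, where `W = diag(Q⁻¹, R⁻¹)`. -/
noncomputable def gain {m p r k : ℕ} (S : LTI m p r k) (Q : Matrix (Fin m) (Fin m) ℝ)
    (R : Matrix (Fin p) (Fin p) ℝ) (P : Matrix (Fin r) (Fin r) ℝ) : Matrix (Fin k) (Fin r) ℝ :=
  if S.D ≠ 0 then
    (S.Dᵀ * weight Q R * S.D)⁻¹ * (S.Bᵀ * P + S.Dᵀ * weight Q R * S.C)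
  else 0

/-- `P` solves on `[0, t₁]` the Riccati differential equation
`Ṗ = Aᵀ P + P A - Kᵀ (Dᵀ W D) K + Cᵀ W C`, `P(0) = C_sᵀ Q̄₀ C_s`, where `K(t)` is the gain that
belongs to `P(t)` (entrywise derivatives, one-sided at the end points). -/
structure IsRiccatiSolution {m n p r k : ℕ} (S : LTI m p r k) (F : Matrix (Fin m) (Fin n) ℝ)
    (Q₀ Q : Matrix (Fin m) (Fin m) ℝ) (R : Matrix (Fin p) (Fin p) ℝ) (t₁ : ℝ)
    (P : ℝ → Matrix (Fin r) (Fin r) ℝ) : Prop where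
  init : P 0 = S.Csᵀ * Qbar F Q₀ * S.Cs
  deriv : ∀ t ∈ Icc 0 t₁, ∀ i j, HasDerivWithinAt (fun s => P s i j)
    ((S.Aᵀ * P t + P t * S.A
      - (gain S Q R (P t))ᵀ * (S.Dᵀ * weight Q R * S.D) * gain S Q R (P t)
      + S.Cᵀ * weight Q R * S.C) i j) (Icc 0 t₁) t

/-- `v ∈ AC([0, t₁])` solves `v̇(s) = (A - B K(t₁ - s)) v(s)` a.e., `v(0) = 𝓜 Fᵀ ℓ`. -/
structure IsClosedLoopState {m n p r k : ℕ} (S : LTI m p r k) (F : Matrix (Fin m) (Fin n) ℝ)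
    (Q : Matrix (Fin m) (Fin m) ℝ) (R : Matrix (Fin p) (Fin p) ℝ) (ℓ : Fin m → ℝ) (t₁ : ℝ)
    (P : ℝ → Matrix (Fin r) (Fin r) ℝ) (v : ℝ → Fin r → ℝ) : Prop where
  ac : ACOn (Icc 0 t₁) v
  init : v 0 = S.stateMap F *ᵥ (Fᵀ *ᵥ ℓ)
  deriv : ∀ᵐ s ∂volume.restrict (Icc 0 t₁),
    HasDerivAt v ((S.A - S.B * gain S Q R (P (t₁ - s))) *ᵥ v s) s

/-- `u*(s) = (C_u - D_u K(t₁ - s)) v(s)`. -/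
noncomputable def optimalControl {m p r k : ℕ} (S : LTI m p r k)
    (Q : Matrix (Fin m) (Fin m) ℝ) (R : Matrix (Fin p) (Fin p) ℝ) (t₁ : ℝ)
    (P : ℝ → Matrix (Fin r) (Fin r) ℝ) (v : ℝ → Fin r → ℝ) : ℝ → Fin p → ℝ :=
  fun s => (S.Cu - S.Du * gain S Q R (P (t₁ - s))) *ᵥ v s

/-- `r ∈ AC([0, t₁])` solves `ṙ(t) = (A - B K(t))ᵀ r(t) + (C_u - D_u K(t))ᵀ y(t)` a.e.,
`r(0) = 0`. -/
structure IsObserverState {m p d k : ℕ} (S : LTI m p d k)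
    (Q : Matrix (Fin m) (Fin m) ℝ) (R : Matrix (Fin p) (Fin p) ℝ) (t₁ : ℝ)
    (P : ℝ → Matrix (Fin d) (Fin d) ℝ) (y : ℝ → Fin p → ℝ) (r : ℝ → Fin d → ℝ) : Prop where
  ac : ACOn (Icc 0 t₁) r
  init : r 0 = 0
  deriv : ∀ᵐ t ∂volume.restrict (Icc 0 t₁),
    HasDerivAt r ((S.A - S.B * gain S Q R (P t))ᵀ *ᵥ r t
      + (S.Cu - S.Du * gain S Q R (P t))ᵀ *ᵥ y t) t

/-! A solution `(q, u)` of the dual equation with initial value `Fᵀℓ` turns the error of the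
observer `t ↦ u(t₁ - t)` into a linear functional of the disturbances alone. For any `a` such that
`Fᵀa` is the terminal value of `Fᵀq`, the error equals `aᵀFx(0) + ∫ (q(t₁ - t)ᵀf - u(t₁ - t)ᵀη) dt`
(`IsDAESolution.duality`, `IsSolution.error_eq`). Weighted Cauchy–Schwarz bounds its square on
admissible solutions by the dual cost `J = aᵀQ₀⁻¹a + ∫ (qᵀQ⁻¹q + uᵀR⁻¹u) dt`.

Minimising `J` is a linear-quadratic control problem: the associated system parametrises the dual
solutions, and `Mopt` selects the cheapest `a`, which produces the terminal weight `Qbar`. The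
Riccati feedback solves it. By `IsRiccatiSolution.integral_cost` the bilinear cost between any
trajectory and a closed-loop one is a boundary term. Hence (`IsRiccatiSolution.dual_cost`) the
closed-loop solution has the claimed cost and is orthogonal, in the dual cost, to every dual
solution with zero initial value.

The lower bound holds for all `U` at once. On solutions with `y = 0` an observer contributes
nothing, so the worst-case error of any `U` dominates the squares of the closed-loop functional `φ`
over zero-output disturbances in the unit ball. Whatever is orthogonal to these disturbances is a
dual solution with zero initial value (`exists_isDualSolution_of_orthogonal`), so stationarity puts
`φ` into the closure of the zero-output subspace, where that supremum is `‖φ‖² = J`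
(`inner_self_le_of_mem_closure`, `worstCaseError_of_dual_optimal`).

Global solvability of the Riccati equation follows from an a priori bound: solutions are symmetric
and nonnegative, being solutions of Lyapunov equations, so the trace controls all entries, and
Grönwall controls the trace. The recursive form of the observer comes from pairing its state with
the time-reversed closed-loop state. -/

/-! ### Global existence for ordinary differential equations -/

/-- Coordinatewise truncation to `[-ρ, ρ]`. -/
noncomputable def clampPi {ι : Type*} (ρ : ℝ) (x : ι → ℝ) : ι → ℝ :=
  fun i => max (-ρ) (min ρ (x i))

theorem lipschitzWith_clampPi {ι : Type*} [Fintype ι] (ρ : ℝ) :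
    LipschitzWith 1 (clampPi ρ : (ι → ℝ) → ι → ℝ) := by
  refine LipschitzWith.of_dist_le_mul fun x y => ?_
  rw [NNReal.coe_one, one_mul, dist_pi_le_iff dist_nonneg]
  intro i
  refine le_trans ?_ (dist_le_pi_dist x y i)
  have h := ((LipschitzWith.id (α := ℝ)).const_min ρ).const_max (-ρ)
  simpa [clampPi] using h.dist_le_mul (x i) (y i)

theorem norm_clampPi_le {ι : Type*} [Fintype ι] {ρ : ℝ} (hρ : 0 ≤ ρ) (x : ι → ℝ) :
    ‖clampPi ρ x‖ ≤ ρ := by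
  rw [pi_norm_le_iff_of_nonneg hρ]
  intro i
  rw [Real.norm_eq_abs, abs_le]
  exact ⟨le_max_left _ _, max_le (by linarith) (min_le_left _ _)⟩

theorem clampPi_of_norm_le {ι : Type*} [Fintype ι] {ρ : ℝ} {x : ι → ℝ} (hx : ‖x‖ ≤ ρ) :
    clampPi ρ x = x := by
  funext i
  have := (norm_le_pi_norm x i).trans hx
  rw [Real.norm_eq_abs, abs_le] at this
  simp [clampPi, this.1, this.2]

/-- An ordinary differential equation whose solutions satisfy an a priori bound has a solution
on the whole time interval. -/
theorem exists_ode_solution_of_bound {ι : Type*} [Fintype ι] {f : ℝ → (ι → ℝ) → ι → ℝ} {T : ℝ}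
    (hT : 0 ≤ T) (x₀ : ι → ℝ) (R : ℝ) (K : NNReal)
    (hLip : ∀ t ∈ Icc 0 T, LipschitzOnWith K (f t) (Metric.closedBall 0 (R + 1)))
    (hcont : ∀ x, ContinuousOn (fun t => f t x) (Icc 0 T))
    (hbound : ∀ τ ∈ Icc 0 T, ∀ x : ℝ → ι → ℝ, x 0 = x₀ →
      (∀ t ∈ Icc 0 τ, HasDerivWithinAt x (f t (x t)) (Icc 0 τ) t) → ‖x τ‖ ≤ R) :
    ∃ x : ℝ → ι → ℝ, x 0 = x₀ ∧
      ∀ t ∈ Icc 0 T, HasDerivWithinAt x (f t (x t)) (Icc 0 T) t := by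
  -- On the degenerate interval `[0, 0]` every function has every derivative, so the a priori bound
  -- applies to the constant `x₀`.
  have hx₀ : ‖x₀‖ ≤ R := by
    refine hbound 0 ⟨le_rfl, hT⟩ (fun _ => x₀) rfl fun t ht => ?_
    exact HasFDerivWithinAt.of_subsingleton (by simp)
  have hR : 0 ≤ R := (norm_nonneg _).trans hx₀
  have hmem : ∀ x, clampPi (R + 1) x ∈ Metric.closedBall (0 : ι → ℝ) (R + 1) := fun x => by
    simpa using norm_clampPi_le (by linarith) x
  obtain ⟨B, hB⟩ := isCompact_Icc.exists_bound_of_continuousOn (hcont 0)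
  have hbd : ∀ t ∈ Icc 0 T, ∀ x, ‖f t (clampPi (R + 1) x)‖ ≤ B + K * (R + 1) := by
    intro t ht x
    have h1 := (hLip t ht).dist_le_mul _ (hmem x) 0 (by simp; linarith)
    have h2 := hmem x
    rw [mem_closedBall_zero_iff] at h2
    rw [dist_zero_right, dist_eq_norm] at h1
    calc _ = ‖(f t (clampPi (R + 1) x) - f t 0) + f t 0‖ := by simp
      _ ≤ K * ‖clampPi (R + 1) x‖ + B := (norm_add_le _ _).trans (add_le_add h1 (hB t ht))
      _ ≤ _ := by nlinarith [K.coe_nonneg]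
  have hB0 : 0 ≤ B + K * (R + 1) := (norm_nonneg _).trans (hbd 0 ⟨le_rfl, hT⟩ 0)
  -- The truncated field is bounded and Lipschitz on the whole space; a ball of radius (speed bound)
  -- times `T` is therefore large enough for one Picard–Lindelöf application to cover `[0, T]`.
  have hPL : IsPicardLindelof (fun t x => f t (clampPi (R + 1) x))
      (⟨0, le_rfl, hT⟩ : Icc (0 : ℝ) T) x₀ (⟨(B + K * (R + 1)) * T, by positivity⟩ : NNReal) 0
      ⟨B + K * (R + 1), hB0⟩ K := by
    refine ⟨fun t ht => ?_, fun x _ => hcont _, fun t ht x _ => hbd t ht x, ?_⟩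
    · have := (hLip t ht).comp ((lipschitzWith_clampPi (R + 1)).lipschitzOnWith
        (s := Metric.closedBall x₀ ((B + K * (R + 1)) * T))) (fun x _ => hmem x)
      rw [mul_one] at this
      exact this
    · simp only [sub_zero, sub_self, max_eq_left hT, NNReal.coe_zero]
      exact le_rfl
  obtain ⟨x, hx0, hx⟩ := hPL.exists_eq_forall_mem_Icc_hasDerivWithinAt₀
  simp only at hx0
  have hxc : ContinuousOn x (Icc 0 T) := fun t ht => (hx t ht).continuousWithinAt
  have hstay : ∀ τ ∈ Icc 0 T, (∀ t ∈ Icc 0 τ, ‖x t‖ ≤ R + 1) → ‖x τ‖ ≤ R := by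
    intro τ hτ h
    refine hbound τ hτ x hx0 fun t ht => ?_
    have h1 := (hx t ⟨ht.1, ht.2.trans hτ.2⟩).mono (Icc_subset_Icc_right hτ.2)
    rwa [clampPi_of_norm_le (h t ht)] at h1
  -- First-exit argument: otherwise there is a first time `τ` with norm exactly `R + 1`. Up to `τ`
  -- the truncation is inactive, so the a priori bound gives norm at most `R` at `τ`, a
  -- contradiction.
  have hall : ∀ t ∈ Icc 0 T, ‖x t‖ ≤ R + 1 := by
    by_contra! hcon
    obtain ⟨t, ht, hlt⟩ := hcon
    have hne : ∀ s ∈ Icc 0 T, R + 1 < ‖x s‖ → ∃ s' ∈ Icc 0 s, ‖x s'‖ = R + 1 := by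
      intro s hs hlt
      have := intermediate_value_Icc hs.1 (hxc.norm.mono (Icc_subset_Icc_right hs.2))
      obtain ⟨s', hs', he⟩ := this ⟨by rw [hx0]; linarith, hlt.le⟩
      exact ⟨s', hs', he⟩
    have hAc : IsCompact (Icc 0 T ∩ (fun s => ‖x s‖) ⁻¹' {R + 1}) :=
      isCompact_Icc.of_isClosed_subset
        (hxc.norm.preimage_isClosed_of_isClosed isClosed_Icc isClosed_singleton) inter_subset_left
    obtain ⟨s, hs, he⟩ := hne t ht hlt
    obtain ⟨τ, ⟨hτ, hτe⟩, hmin⟩ := hAc.exists_isLeast ⟨s, ⟨hs.1, hs.2.trans ht.2⟩, he⟩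
    have := hstay τ hτ fun r hr => by
      by_contra! hr'
      obtain ⟨s', hs', he'⟩ := hne r ⟨hr.1, hr.2.trans hτ.2⟩ hr'
      have h1 : τ ≤ s' := hmin ⟨⟨hs'.1, hs'.2.trans (hr.2.trans hτ.2)⟩, he'⟩
      have h2 : r = τ := le_antisymm hr.2 (h1.trans hs'.2)
      rw [h2] at hr'
      exact hr'.ne' hτe
    simp only [mem_preimage, mem_singleton_iff] at hτe
    linarith
  refine ⟨x, hx0, fun t ht => ?_⟩
  have h1 := hx t ht
  rwa [clampPi_of_norm_le (hall t ht)] at h1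

theorem norm_mulVec_le_sum {ι κ : Type*} [Fintype ι] [Fintype κ] (M : Matrix ι κ ℝ) (x : κ → ℝ) :
    ‖M *ᵥ x‖ ≤ (∑ i, ∑ j, |M i j|) * ‖x‖ := by
  rw [pi_norm_le_iff_of_nonneg (by positivity)]
  intro i
  calc ‖(M *ᵥ x) i‖ ≤ ∑ j, |M i j| * ‖x‖ := by
        refine (norm_sum_le _ _).trans (Finset.sum_le_sum fun j _ => ?_)
        rw [norm_mul, Real.norm_eq_abs]
        gcongr
        exact norm_le_pi_norm x j
    _ = (∑ j, |M i j|) * ‖x‖ := by rw [Finset.sum_mul]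
    _ ≤ _ := by
        gcongr
        exact Finset.single_le_sum (f := fun i => ∑ j, |M i j|)
          (fun _ _ => Finset.sum_nonneg fun _ _ => abs_nonneg _) (Finset.mem_univ i)

/-- Bound, uniform on a compact interval, of the operator norms of a continuous matrix function. -/
theorem exists_norm_mulVec_le {ι κ : Type*} [Fintype ι] [Fintype κ] {M : ℝ → Matrix ι κ ℝ}
    {a b : ℝ} (hM : ContinuousOn M (Icc a b)) :
    ∃ C : NNReal, ∀ t ∈ Icc a b, ∀ x, ‖M t *ᵥ x‖ ≤ C * ‖x‖ := by
  have hc : ContinuousOn (fun t => ∑ i, ∑ j, |M t i j|) (Icc a b) := by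
    refine continuousOn_finsetSum _ fun i _ => continuousOn_finsetSum _ fun j _ => ?_
    exact (continuousOn_pi.1 (continuousOn_pi.1 hM i) j).abs
  obtain ⟨C, hC⟩ := isCompact_Icc.exists_bound_of_continuousOn hc
  refine ⟨C.toNNReal, fun t ht x => (norm_mulVec_le_sum _ _).trans ?_⟩
  gcongr
  exact (le_abs_self _).trans ((hC t ht).trans (Real.le_coe_toNNReal C))

/-- Grönwall's inequality and the constancy criterion used below are formulated with right
derivatives. -/
theorem HasDerivWithinAt.Ici_of_Icc {E : Type*} [NormedAddCommGroup E] [NormedSpace ℝ E]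
    {f : ℝ → E} {f' : E} {a b t : ℝ} (h : HasDerivWithinAt f f' (Icc a b) t)
    (ht : t ∈ Ico a b) : HasDerivWithinAt f f' (Ici t) t :=
  h.mono_of_mem_nhdsWithin (Icc_mem_nhdsGE_of_mem ht)

/-- Affine differential equations with continuous coefficients have global solutions. -/
theorem exists_affine_ode_solution {ι : Type*} [Fintype ι] {M : ℝ → Matrix ι ι ℝ}
    {b : ℝ → ι → ℝ} {T : ℝ} (hT : 0 ≤ T) (hM : ContinuousOn M (Icc 0 T))
    (hb : ContinuousOn b (Icc 0 T)) (x₀ : ι → ℝ) :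
    ∃ x : ℝ → ι → ℝ, x 0 = x₀ ∧
      ∀ t ∈ Icc 0 T, HasDerivWithinAt x (M t *ᵥ x t + b t) (Icc 0 T) t := by
  obtain ⟨C, hC⟩ := exists_norm_mulVec_le hM
  obtain ⟨β, hβ⟩ := isCompact_Icc.exists_bound_of_continuousOn hb
  have hβ0 : 0 ≤ β := (norm_nonneg _).trans (hβ 0 ⟨le_rfl, hT⟩)
  -- The a priori bound is Grönwall's at the final time, which dominates the bound at each earlier
  -- `τ`; the operator norm bound `C` also serves as Lipschitz constant.
  refine exists_ode_solution_of_bound (f := fun t x => M t *ᵥ x + b t) hT x₀ (gronwallBound ‖x₀‖ C β T) C ?_ ?_ ?_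
  · intro t ht
    refine LipschitzOnWith.of_dist_le_mul fun x _ y _ => ?_
    rw [dist_add_right, dist_eq_norm, dist_eq_norm, ← mulVec_sub]
    exact hC t ht _
  · intro x
    refine ContinuousOn.add ?_ hb
    refine continuousOn_pi.2 fun i => continuousOn_finsetSum _ fun j _ => ?_
    exact (continuousOn_pi.1 (continuousOn_pi.1 hM i) j).mul continuousOn_const
  · intro τ hτ x hx0 hx
    have := norm_le_gronwallBound_of_norm_deriv_right_le (K := C) (ε := β) (δ := ‖x₀‖)
      (fun t ht => (hx t ht).continuousWithinAt)
      (fun t ht => (hx t (Ico_subset_Icc_self ht)).Ici_of_Icc ht) (by rw [hx0])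
      (fun t ht => (norm_add_le _ _).trans
        (add_le_add (hC t ⟨ht.1, ht.2.le.trans hτ.2⟩ _) (hβ t ⟨ht.1, ht.2.le.trans hτ.2⟩)))
      τ ⟨hτ.1, le_rfl⟩
    refine this.trans ?_
    rw [sub_zero]
    exact gronwallBound_mono (norm_nonneg _) hβ0 C.coe_nonneg hτ.2

/-! ### Absolutely continuous vector functions -/

theorem acOn_Icc_iff {d : ℕ} {T : ℝ} (hT : 0 ≤ T) {f : ℝ → Fin d → ℝ} :
    ACOn (Icc 0 T) f ↔ AbsolutelyContinuousOnInterval f 0 T := by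
  refine ⟨fun h => h 0 T hT subset_rfl, fun h a b hab hs => h.mono ?_⟩
  rwa [uIcc_of_le hab, uIcc_of_le hT]

theorem l2Loc_Icc_iff {d : ℕ} {T : ℝ} {f : ℝ → Fin d → ℝ} :
    L2Loc (Icc 0 T) f ↔ MemLp f 2 (volume.restrict (Icc 0 T)) :=
  ⟨fun h => h 0 T subset_rfl, fun h _ _ hs => h.mono_measure (Measure.restrict_mono_set _ hs)⟩

/-- The sup distance dominates each coordinate distance and is at most their sum, so both directions
are squeezes. -/
theorem absolutelyContinuousOnInterval_pi {ι : Type*} [Fintype ι] {f : ℝ → ι → ℝ} {a b : ℝ} :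
    AbsolutelyContinuousOnInterval f a b ↔
      ∀ i, AbsolutelyContinuousOnInterval (fun t => f t i) a b := by
  constructor
  · intro h i
    refine squeeze_zero (fun E => Finset.sum_nonneg fun _ _ => dist_nonneg) (fun E => ?_) h
    exact Finset.sum_le_sum fun j _ => dist_le_pi_dist _ _ i
  · intro h
    refine squeeze_zero (fun E => Finset.sum_nonneg fun _ _ => dist_nonneg) (fun E => ?_)
      (by simpa using tendsto_finsetSum Finset.univ fun i _ => h i)
    rw [Finset.sum_comm]
    refine Finset.sum_le_sum fun j _ => ?_
    rw [dist_pi_le_iff (Finset.sum_nonneg fun _ _ => dist_nonneg)]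
    intro i
    exact Finset.single_le_sum (f := fun i => dist (f (E.2 j).1 i) (f (E.2 j).2 i))
      (fun _ _ => dist_nonneg) (Finset.mem_univ i)

theorem absolutelyContinuousOnInterval_const {E : Type*} [PseudoMetricSpace E] (c : E) (a b : ℝ) :
    AbsolutelyContinuousOnInterval (fun _ => c) a b := by
  simpa [AbsolutelyContinuousOnInterval] using tendsto_const_nhds

theorem AbsolutelyContinuousOnInterval.congr {E : Type*} [PseudoMetricSpace E] {f g : ℝ → E}
    {a b : ℝ} (hf : AbsolutelyContinuousOnInterval f a b) (h : EqOn f g (uIcc a b)) :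
    AbsolutelyContinuousOnInterval g a b := by
  rw [absolutelyContinuousOnInterval_iff] at hf ⊢
  intro ε hε
  obtain ⟨δ, hδ, H⟩ := hf ε hε
  refine ⟨δ, hδ, fun E hE hlt => (H E hE hlt).trans_eq' ?_⟩
  refine Finset.sum_congr rfl fun i hi => ?_
  rw [h (hE.1 i hi).1, h (hE.1 i hi).2]

theorem AbsolutelyContinuousOnInterval.finset_sum {ι : Type*} (s : Finset ι) {f : ι → ℝ → ℝ}
    {a b : ℝ} (h : ∀ i ∈ s, AbsolutelyContinuousOnInterval (f i) a b) :
    AbsolutelyContinuousOnInterval (fun t => ∑ i ∈ s, f i t) a b := by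
  classical
  induction s using Finset.induction_on with
  | empty => simpa using absolutelyContinuousOnInterval_const (0 : ℝ) a b
  | insert i s hi ih =>
    simp only [Finset.sum_insert hi]
    exact (h i (by simp)).fun_add (ih fun j hj => h j (by simp [hj]))

theorem AbsolutelyContinuousOnInterval.dotProduct {ι : Type*} [Fintype ι] {f g : ℝ → ι → ℝ}
    {a b : ℝ} (hf : AbsolutelyContinuousOnInterval f a b)
    (hg : AbsolutelyContinuousOnInterval g a b) :
    AbsolutelyContinuousOnInterval (fun t => f t ⬝ᵥ g t) a b :=
  .finset_sum _ fun i _ => (absolutelyContinuousOnInterval_pi.1 hf i).fun_mul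
    (absolutelyContinuousOnInterval_pi.1 hg i)

theorem AbsolutelyContinuousOnInterval.mulVec {ι κ : Type*} [Fintype ι] [Fintype κ]
    {f : ℝ → ι → ℝ} {a b : ℝ} (hf : AbsolutelyContinuousOnInterval f a b) (M : Matrix κ ι ℝ) :
    AbsolutelyContinuousOnInterval (fun t => M *ᵥ f t) a b :=
  absolutelyContinuousOnInterval_pi.2 fun i =>
    AbsolutelyContinuousOnInterval.dotProduct (absolutelyContinuousOnInterval_const (M i) a b) hf

theorem HasDerivAt.dotProduct {ι : Type*} [Fintype ι] {f g : ℝ → ι → ℝ} {f' g' : ι → ℝ} {t : ℝ}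
    (hf : HasDerivAt f f' t) (hg : HasDerivAt g g' t) :
    HasDerivAt (fun s => f s ⬝ᵥ g s) (f' ⬝ᵥ g t + f t ⬝ᵥ g') t := by
  have := HasDerivAt.fun_sum (u := Finset.univ) fun i _ =>
    (hasDerivAt_pi.1 hf i).fun_mul (hasDerivAt_pi.1 hg i)
  simpa [_root_.dotProduct, Finset.sum_add_distrib] using this

theorem HasDerivAt.matrix_mulVec {ι κ : Type*} [Fintype ι] [Fintype κ] {f : ℝ → ι → ℝ} {f' : ι → ℝ}
    {t : ℝ} (M : Matrix κ ι ℝ) (hf : HasDerivAt f f' t) :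
    HasDerivAt (fun s => M *ᵥ f s) (M *ᵥ f') t :=
  (M.mulVecLin.toContinuousLinearMap.hasFDerivAt.comp_hasDerivAt t hf :)

theorem ae_uIoc_of_ae_Icc {T : ℝ} (hT : 0 ≤ T) {p : ℝ → Prop}
    (h : ∀ᵐ t ∂volume.restrict (Icc 0 T), p t) : ∀ᵐ t, t ∈ uIoc 0 T → p t := by
  rw [ae_restrict_iff' measurableSet_Icc] at h
  filter_upwards [h] with t ht hmem
  rw [uIoc_of_le hT] at hmem
  exact ht (Ioc_subset_Icc_self hmem)

theorem intervalIntegral_congr_ae_Icc {E : Type*} [NormedAddCommGroup E] [NormedSpace ℝ E]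
    {T t : ℝ} {f g : ℝ → E} (ht : t ∈ Icc 0 T)
    (h : ∀ᵐ t ∂volume.restrict (Icc 0 T), f t = g t) :
    ∫ s in (0 : ℝ)..t, f s = ∫ s in (0 : ℝ)..t, g s := by
  refine intervalIntegral.integral_congr_ae (ae_uIoc_of_ae_Icc ht.1 ?_)
  exact ae_mono (Measure.restrict_mono_set _ (Icc_subset_Icc_right ht.2)) h

/-- Fundamental theorem of calculus for scalar absolutely continuous functions. -/
theorem AbsolutelyContinuousOnInterval.integral_eq_sub_of_ae {f f' : ℝ → ℝ} {T : ℝ} (hT : 0 ≤ T)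
    (hf : AbsolutelyContinuousOnInterval f 0 T)
    (hd : ∀ᵐ t ∂volume.restrict (Icc 0 T), HasDerivAt f (f' t) t) :
    ∫ t in (0 : ℝ)..T, f' t = f T - f 0 := by
  rw [← hf.integral_deriv_eq_sub]
  refine intervalIntegral_congr_ae_Icc ⟨hT, le_rfl⟩ ?_
  filter_upwards [hd] with t ht
  exact ht.deriv.symm

/-- Integration by parts for the dot product of absolutely continuous vector functions. -/
theorem AbsolutelyContinuousOnInterval.integral_dotProduct {ι : Type*} [Fintype ι]
    {f g f' g' : ℝ → ι → ℝ} {T : ℝ} (hT : 0 ≤ T)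
    (hf : AbsolutelyContinuousOnInterval f 0 T) (hg : AbsolutelyContinuousOnInterval g 0 T)
    (hf' : ∀ᵐ t ∂volume.restrict (Icc 0 T), HasDerivAt f (f' t) t)
    (hg' : ∀ᵐ t ∂volume.restrict (Icc 0 T), HasDerivAt g (g' t) t) :
    ∫ t in (0 : ℝ)..T, (f' t ⬝ᵥ g t + f t ⬝ᵥ g' t) = f T ⬝ᵥ g T - f 0 ⬝ᵥ g 0 := by
  refine (hf.dotProduct hg).integral_eq_sub_of_ae hT ?_
  filter_upwards [hf', hg'] with t h1 h2 using h1.dotProduct h2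

theorem intervalIntegral_apply {ι : Type*} [Fintype ι] {g : ℝ → ι → ℝ} {a b : ℝ}
    (hg : IntervalIntegrable g volume a b) (i : ι) :
    (∫ t in a..b, g t) i = ∫ t in a..b, g t i :=
  ((ContinuousLinearMap.proj (R := ℝ) (φ := fun _ : ι => ℝ) i).intervalIntegral_comp_comm hg).symm

theorem IntervalIntegrable.apply {ι : Type*} [Fintype ι] {g : ℝ → ι → ℝ} {a b : ℝ}
    (hg : IntervalIntegrable g volume a b) (i : ι) :
    IntervalIntegrable (fun t => g t i) volume a b :=
  ⟨((integrable_pi_iff).1 hg.1 i), ((integrable_pi_iff).1 hg.2 i)⟩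

theorem MeasureTheory.IntegrableOn.intervalIntegrable_Icc {E : Type*} [NormedAddCommGroup E] {g : ℝ → E} {T t : ℝ}
    (hg : IntegrableOn g (Icc 0 T)) (ht : t ∈ Icc 0 T) : IntervalIntegrable g volume 0 t := by
  rw [intervalIntegrable_iff, uIoc_of_le ht.1]
  exact hg.mono_set (Ioc_subset_Icc_self.trans (Icc_subset_Icc_right ht.2))

/-- A primitive of an integrable vector function is absolutely continuous. -/
theorem absolutelyContinuousOnInterval_of_eq_integral {ι : Type*} [Fintype ι] {f g : ℝ → ι → ℝ}
    {T : ℝ} (hT : 0 ≤ T) (hg : IntegrableOn g (Icc 0 T))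
    (h : ∀ t ∈ Icc 0 T, f t = f 0 + ∫ s in (0 : ℝ)..t, g s) :
    AbsolutelyContinuousOnInterval f 0 T := by
  rw [absolutelyContinuousOnInterval_pi]
  intro i
  have hi := hg.intervalIntegrable_Icc ⟨hT, le_rfl⟩
  have h1 := (absolutelyContinuousOnInterval_const (f 0 i) 0 T).fun_add
    ((hi.apply i).absolutelyContinuousOnInterval_intervalIntegral (c := 0) (by simp))
  refine h1.congr fun t ht => ?_
  rw [uIcc_of_le hT] at ht
  simp only [h t ht, Pi.add_apply, intervalIntegral_apply (hg.intervalIntegrable_Icc ht)]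

/-- A primitive of an integrable vector function is differentiable almost everywhere. -/
theorem ae_hasDerivAt_of_eq_integral {ι : Type*} [Fintype ι] {f g : ℝ → ι → ℝ}
    {T : ℝ} (hT : 0 ≤ T) (hg : IntegrableOn g (Icc 0 T))
    (h : ∀ t ∈ Icc 0 T, f t = f 0 + ∫ s in (0 : ℝ)..t, g s) :
    ∀ᵐ t ∂volume.restrict (Icc 0 T), HasDerivAt f (g t) t := by
  have h1 := (hg.intervalIntegrable_Icc ⟨hT, le_rfl⟩).ae_hasDerivAt_integral
  rw [uIcc_of_le hT] at h1
  -- The formula for `f` is known on `[0, T]` only. It holds near interior points, which gives a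
  -- two-sided derivative there, and the end points are a null set.
  rw [← restrict_Ioo_eq_restrict_Icc, ae_restrict_iff' measurableSet_Ioo]
  filter_upwards [h1] with t ht hmem
  have h2 := (ht (Ioo_subset_Icc_self hmem) 0 ⟨le_rfl, hT⟩).const_add (f 0)
  refine h2.congr_of_eventuallyEq ?_
  filter_upwards [Icc_mem_nhds hmem.1 hmem.2] with s hs using h s hs

theorem AbsolutelyContinuousOnInterval.integrableOn_of_ae {ι : Type*} [Fintype ι]
    {f f' : ℝ → ι → ℝ} {T : ℝ} (hT : 0 ≤ T) (hf : AbsolutelyContinuousOnInterval f 0 T)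
    (hd : ∀ᵐ t ∂volume.restrict (Icc 0 T), HasDerivAt f (f' t) t) :
    IntegrableOn f' (Icc 0 T) := by
  refine integrable_pi_iff.2 fun i => ?_
  have h1 := (absolutelyContinuousOnInterval_pi.1 hf i).intervalIntegrable_deriv
  rw [intervalIntegrable_iff, uIoc_of_le hT, ← integrableOn_Icc_iff_integrableOn_Ioc] at h1
  refine h1.congr ?_
  filter_upwards [hd] with t ht using (hasDerivAt_pi.1 ht i).deriv

theorem AbsolutelyContinuousOnInterval.eq_add_integral {ι : Type*} [Fintype ι]
    {f f' : ℝ → ι → ℝ} {T : ℝ} (hf : AbsolutelyContinuousOnInterval f 0 T)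
    (hd : ∀ᵐ t ∂volume.restrict (Icc 0 T), HasDerivAt f (f' t) t) {t : ℝ} (ht : t ∈ Icc 0 T) :
    f t = f 0 + ∫ s in (0 : ℝ)..t, f' s := by
  have hT : 0 ≤ T := ht.1.trans ht.2
  have hint := (hf.integrableOn_of_ae hT hd).intervalIntegrable_Icc ht
  have hs : uIcc 0 t ⊆ uIcc 0 T := by
    rw [uIcc_of_le ht.1, uIcc_of_le hT]; exact Icc_subset_Icc_right ht.2
  have hd' := ae_mono (Measure.restrict_mono_set volume (Icc_subset_Icc_right ht.2)) hd
  funext i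
  rw [Pi.add_apply, intervalIntegral_apply hint,
    (absolutelyContinuousOnInterval_pi.1 (hf.mono hs) i).integral_eq_sub_of_ae ht.1
      (f' := fun s => f' s i) ?_]
  · ring
  · filter_upwards [hd'] with s h using hasDerivAt_pi.1 h i

/-- Dual solutions are paired with original ones after time reversal; this carries a.e. statements
and integrability across it. -/
theorem measurePreserving_sub_left_Icc (T : ℝ) :
    MeasurePreserving (fun t : ℝ => T - t) (volume.restrict (Icc 0 T))
      (volume.restrict (Icc 0 T)) := by
  have := (Measure.measurePreserving_sub_left (volume : Measure ℝ) T).restrict_preimage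
    (measurableSet_Icc (a := (0 : ℝ)) (b := T))
  simpa using this

theorem ae_Icc_comp_sub_left {T : ℝ} {p : ℝ → Prop}
    (h : ∀ᵐ t ∂volume.restrict (Icc 0 T), p t) :
    ∀ᵐ t ∂volume.restrict (Icc 0 T), p (T - t) :=
  (measurePreserving_sub_left_Icc T).quasiMeasurePreserving.ae h

theorem memLp_comp_sub_left {E : Type*} [NormedAddCommGroup E] {T : ℝ} {f : ℝ → E}
    {p : ENNReal} (h : MemLp f p (volume.restrict (Icc 0 T))) :
    MemLp (fun t => f (T - t)) p (volume.restrict (Icc 0 T)) :=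
  h.comp_measurePreserving (measurePreserving_sub_left_Icc T)

theorem HasDerivAt.comp_sub_left {E : Type*} [NormedAddCommGroup E] [NormedSpace ℝ E] {f : ℝ → E}
    {f' : E} {T t : ℝ} (h : HasDerivAt f f' (T - t)) :
    HasDerivAt (fun s => f (T - s)) (-f') t := by
  have := h.scomp t ((hasDerivAt_id t).const_sub T)
  rw [neg_one_smul] at this
  exact this

/-- Writing `f` as the primitive of its a.e. derivative reduces time reversal to a substitution in
the integral. -/
theorem AbsolutelyContinuousOnInterval.comp_sub_left {ι : Type*} [Fintype ι] {f : ℝ → ι → ℝ} {T : ℝ}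
    (hT : 0 ≤ T) (hf : AbsolutelyContinuousOnInterval f 0 T) :
    AbsolutelyContinuousOnInterval (fun t => f (T - t)) 0 T := by
  have hd : ∀ᵐ t ∂volume.restrict (Icc 0 T), HasDerivAt f (fun i => deriv (fun s => f s i) t) t := by
    rw [ae_restrict_iff' measurableSet_Icc]
    have : ∀ᵐ t, ∀ i, t ∈ uIcc 0 T → DifferentiableAt ℝ (fun s => f s i) t :=
      ae_all_iff.2 fun i => (absolutelyContinuousOnInterval_pi.1 hf i).ae_differentiableAt
    filter_upwards [this] with t ht hmem
    exact hasDerivAt_pi.2 fun i => (ht i (by rwa [uIcc_of_le hT])).hasDerivAt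
  have hint := hf.integrableOn_of_ae hT hd
  set f' : ℝ → ι → ℝ := fun t i => deriv (fun s => f s i) t
  refine absolutelyContinuousOnInterval_of_eq_integral hT
    (g := fun t => -f' (T - t)) ?_ fun t ht => ?_
  · exact Integrable.neg ((measurePreserving_sub_left_Icc T).integrable_comp_of_integrable hint)
  · have h1 := hf.eq_add_integral hd (t := T) ⟨hT, le_rfl⟩
    have h2 := hf.eq_add_integral hd (t := T - t) ⟨by linarith [ht.2], by linarith [ht.1]⟩
    rw [intervalIntegral.integral_neg, intervalIntegral.integral_comp_sub_left (fun t => f' t),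
      sub_zero, h1, h2, ← intervalIntegral.integral_add_adjacent_intervals
        (hint.intervalIntegrable_Icc (t := T - t) ⟨by linarith [ht.2], by linarith [ht.1]⟩)
        (?_ : IntervalIntegrable f' volume (T - t) T)]
    · abel
    · exact (hint.intervalIntegrable_Icc (t := T - t)
        ⟨by linarith [ht.2], by linarith [ht.1]⟩).symm.trans
        (hint.intervalIntegrable_Icc ⟨hT, le_rfl⟩)

theorem ContinuousOn.memLp_Icc {E : Type*} [NormedAddCommGroup E]
    [SecondCountableTopology E] {f : ℝ → E} {a b : ℝ} (hf : ContinuousOn f (Icc a b))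
    (p : ENNReal) : MemLp f p (volume.restrict (Icc a b)) := by
  obtain ⟨C, hC⟩ := isCompact_Icc.exists_bound_of_continuousOn hf
  refine MemLp.of_bound (hf.aestronglyMeasurable measurableSet_Icc) C ?_
  rw [ae_restrict_iff' measurableSet_Icc]
  exact Filter.Eventually.of_forall hC

/-- Continuously differentiable functions on a compact interval are absolutely continuous and
differentiable almost everywhere. -/
theorem absolutelyContinuousOnInterval_of_hasDerivWithinAt {E : Type*} [NormedAddCommGroup E]
    [NormedSpace ℝ E] {f f' : ℝ → E} {T : ℝ} (hT : 0 ≤ T)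
    (h : ∀ t ∈ Icc 0 T, HasDerivWithinAt f (f' t) (Icc 0 T) t)
    (hf' : ContinuousOn f' (Icc 0 T)) : AbsolutelyContinuousOnInterval f 0 T := by
  obtain ⟨C, hC⟩ := isCompact_Icc.exists_bound_of_continuousOn hf'
  refine LipschitzOnWith.absolutelyContinuousOnInterval (K := C.toNNReal) ?_
  rw [uIcc_of_le hT]
  refine (convex_Icc 0 T).lipschitzOnWith_of_nnnorm_hasDerivWithin_le h fun t ht => ?_
  rw [← NNReal.coe_le_coe, coe_nnnorm]
  exact (hC t ht).trans (Real.le_coe_toNNReal C)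

theorem ae_hasDerivAt_of_hasDerivWithinAt {E : Type*} [NormedAddCommGroup E]
    [NormedSpace ℝ E] {f f' : ℝ → E} {T : ℝ}
    (h : ∀ t ∈ Icc 0 T, HasDerivWithinAt f (f' t) (Icc 0 T) t) :
    ∀ᵐ t ∂volume.restrict (Icc 0 T), HasDerivAt f (f' t) t := by
  rw [← restrict_Ioo_eq_restrict_Icc, ae_restrict_iff' measurableSet_Ioo]
  exact Filter.Eventually.of_forall fun t ht =>
    (h t (Ioo_subset_Icc_self ht)).hasDerivAt (Icc_mem_nhds ht.1 ht.2)

/-! ### Linear algebra -/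

theorem Matrix.PosDef.transpose_eq {ι : Type*} {M : Matrix ι ι ℝ} (h : M.PosDef) : Mᵀ = M := by
  simpa [conjTranspose_eq_transpose_of_trivial] using h.isHermitian.eq

theorem Matrix.PosDef.dotProduct_pos {ι : Type*} [Fintype ι] {M : Matrix ι ι ℝ} (h : M.PosDef)
    {x : ι → ℝ} (hx : x ≠ 0) : 0 < x ⬝ᵥ (M *ᵥ x) := by
  simpa using h.dotProduct_mulVec_pos hx

theorem Matrix.PosDef.dotProduct_nonneg {ι : Type*} [Fintype ι] {M : Matrix ι ι ℝ} (h : M.PosDef)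
    (x : ι → ℝ) : 0 ≤ x ⬝ᵥ (M *ᵥ x) := by
  simpa using h.posSemidef.dotProduct_mulVec_nonneg x

/-- `(M v) · w = v · (Mᵀ w)`. -/
theorem mulVec_dotProduct_eq {ι κ : Type*} [Fintype ι] [Fintype κ] (M : Matrix ι κ ℝ)
    (v : κ → ℝ) (w : ι → ℝ) : (M *ᵥ v) ⬝ᵥ w = v ⬝ᵥ (Mᵀ *ᵥ w) := by
  rw [dotProduct_mulVec, vecMul_transpose]

theorem mulVec_injective_of_rank_eq {ι : Type*} [Fintype ι] {k : ℕ} {M : Matrix ι (Fin k) ℝ}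
    (h : M.rank = k) : Function.Injective (M *ᵥ ·) := by
  have h1 := LinearMap.finrank_range_add_finrank_ker M.mulVecLin
  rw [← Matrix.rank, h, Module.finrank_fin_fun] at h1
  have h2 : LinearMap.ker M.mulVecLin = ⊥ := Submodule.finrank_eq_zero.1 (by omega)
  exact LinearMap.ker_eq_bot.1 h2

/-- Full column rank makes `M` injective, so `M M⁺ M = M` can be cancelled on the left. This is how
the state map recovers the state from `Fᵀq`. -/
theorem pinv_mulVec_of_rank_eq {ι : Type*} [Fintype ι] {k : ℕ} {M : Matrix ι (Fin k) ℝ}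
    (h : M.rank = k) (v : Fin k → ℝ) : pinv M *ᵥ (M *ᵥ v) = v := by
  apply mulVec_injective_of_rank_eq h
  simp only [mulVec_mulVec, ← Matrix.mul_assoc, (pinv_spec M).mul_mul]

theorem weight_posDef {m p : ℕ} {Q : Matrix (Fin m) (Fin m) ℝ} {R : Matrix (Fin p) (Fin p) ℝ}
    (hQ : Q.PosDef) (hR : R.PosDef) : (weight Q R).PosDef := by
  refine PosDef.of_dotProduct_mulVec_pos ?_ fun x hx => ?_
  · exact IsHermitian.fromBlocks hQ.inv.isHermitian (by simp) hR.inv.isHermitian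
  · obtain ⟨a, b, rfl⟩ : ∃ a b, x = Sum.elim a b :=
      ⟨x ∘ Sum.inl, x ∘ Sum.inr, (Sum.elim_comp_inl_inr x).symm⟩
    simp only [star_trivial, weight, fromBlocks_mulVec, Sum.elim_comp_inl, Sum.elim_comp_inr,
      zero_mulVec, add_zero, zero_add, sumElim_dotProduct_sumElim]
    by_cases ha : a = 0
    · have hb : b ≠ 0 := by
        rintro rfl
        apply hx
        rw [ha]
        ext i; cases i <;> rfl
      exact add_pos_of_nonneg_of_pos (hQ.inv.dotProduct_nonneg a) (hR.inv.dotProduct_pos hb)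
    · exact add_pos_of_pos_of_nonneg (hQ.inv.dotProduct_pos ha) (hR.inv.dotProduct_nonneg b)

theorem dotProduct_weight_mulVec {m p : ℕ} (Q : Matrix (Fin m) (Fin m) ℝ)
    (R : Matrix (Fin p) (Fin p) ℝ) (a a' : Fin m → ℝ) (b b' : Fin p → ℝ) :
    Sum.elim a b ⬝ᵥ (weight Q R *ᵥ Sum.elim a' b') = a ⬝ᵥ (Q⁻¹ *ᵥ a') + b ⬝ᵥ (R⁻¹ *ᵥ b') := by
  simp [weight, fromBlocks_mulVec]

section Pinv

variable {m n : ℕ} (F : Matrix (Fin m) (Fin n) ℝ)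

theorem transpose_mul_kerProj : Fᵀ * kerProj F = 0 := by
  rw [kerProj, Matrix.mul_sub, Matrix.mul_one, ← Matrix.mul_assoc, (pinv_spec Fᵀ).mul_mul, sub_self]

theorem kerProj_transpose : (kerProj F)ᵀ = kerProj F := by
  rw [kerProj, transpose_sub, transpose_one, (pinv_spec Fᵀ).symm_right]

theorem kerProj_mulVec_of_mem {b : Fin m → ℝ} (hb : Fᵀ *ᵥ b = 0) : kerProj F *ᵥ b = b := by
  rw [kerProj, sub_mulVec, one_mulVec, ← mulVec_mulVec, hb, mulVec_zero, sub_zero]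

theorem transpose_mul_Mopt (Q₀ : Matrix (Fin m) (Fin m) ℝ) : Fᵀ * Mopt F Q₀ = 0 := by
  simp only [Mopt, ← Matrix.mul_assoc, transpose_mul_kerProj, Matrix.zero_mul]

theorem pinv_transpose {ι κ : Type*} [Fintype ι] [Fintype κ] (A : Matrix ι κ ℝ) :
    pinv Aᵀ = (pinv A)ᵀ := by
  have h := pinv_spec A
  refine (pinv_spec Aᵀ).unique ⟨?_, ?_, ?_, ?_⟩
  · rw [← transpose_mul, ← transpose_mul, ← Matrix.mul_assoc, h.mul_mul]
  · rw [← transpose_mul, ← transpose_mul, ← Matrix.mul_assoc, h.mul_mul']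
  · rw [← transpose_mul, h.symm_right, h.symm_right]
  · rw [← transpose_mul, h.symm_left, h.symm_left]

/-- `(Fᵀ)⁺ - M_opt` maps `Fᵀ a` to a preimage of `Fᵀ a` under `Fᵀ`. -/
theorem transpose_mulVec_pinv_sub_Mopt (Q₀ : Matrix (Fin m) (Fin m) ℝ) (a : Fin m → ℝ) :
    Fᵀ *ᵥ ((pinv Fᵀ - Mopt F Q₀) *ᵥ (Fᵀ *ᵥ a)) = Fᵀ *ᵥ a := by
  rw [mulVec_mulVec, Matrix.mul_sub, transpose_mul_Mopt, sub_zero, mulVec_mulVec,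
    (pinv_spec Fᵀ).mul_mul]

variable {F}

/-- These are the normal equations for minimising `aᵀQ₀⁻¹a` over all `a` with prescribed `Fᵀa`: at
the minimiser, `Q₀⁻¹a` is orthogonal to the free directions `ker Fᵀ`. With `E` the projection onto
`ker Fᵀ` and `X = E Q₀⁻¹ E`, everything reduces to `X X⁺ E = E`. -/
theorem kerProj_mul_inv_mul_pinv_sub_Mopt {Q₀ : Matrix (Fin m) (Fin m) ℝ} (hQ₀ : Q₀.PosDef) :
    kerProj F * Q₀⁻¹ * (pinv Fᵀ - Mopt F Q₀) = 0 := by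
  have hE := kerProj_transpose F
  set E := kerProj F with hEdef
  have hX : (E * Q₀⁻¹ * E)ᵀ = E * Q₀⁻¹ * E := by
    rw [transpose_mul, transpose_mul, hE, hQ₀.inv.transpose_eq, Matrix.mul_assoc]
  set X := E * Q₀⁻¹ * E with hXdef
  have hp := pinv_spec X
  have h1 : X * (1 - X * pinv X) = 0 := by
    have : (1 - X * pinv X) * X = 0 := by
      rw [Matrix.sub_mul, Matrix.one_mul, hp.mul_mul, sub_self]
    have := congrArg transpose this
    rwa [transpose_mul, transpose_sub, transpose_one, hp.symm_left, hX, transpose_zero] at this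
  -- The columns of `1 - X X⁺` lie in `ker X`, and `ker X = ker E` because `bᵀXb = (Eb)ᵀQ₀⁻¹(Eb)`
  -- with `Q₀⁻¹` positive definite.
  have h2 : E * (1 - X * pinv X) = 0 := by
    refine ext_of_mulVec_single fun i => ?_
    rw [← mulVec_mulVec, zero_mulVec]
    set b := (1 - X * pinv X) *ᵥ Pi.single i 1
    have hb : X *ᵥ b = 0 := by rw [mulVec_mulVec, h1, zero_mulVec]
    by_contra hne
    have := hQ₀.inv.dotProduct_pos hne
    rw [mulVec_dotProduct_eq, hE, mulVec_mulVec, mulVec_mulVec, ← hXdef, hb,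
      dotProduct_zero] at this
    exact lt_irrefl _ this
  have h3 : X * pinv X * E = E := by
    have := congrArg transpose h2
    rw [transpose_mul, transpose_sub, transpose_one, hp.symm_left, hE, transpose_zero,
      Matrix.sub_mul, Matrix.one_mul, sub_eq_zero] at this
    exact this.symm
  calc E * Q₀⁻¹ * (pinv Fᵀ - Mopt F Q₀)
      = E * Q₀⁻¹ * pinv Fᵀ - X * pinv X * E * Q₀⁻¹ * pinv Fᵀ := by
        rw [Matrix.mul_sub, Mopt, ← hEdef, ← hXdef]
        simp only [hXdef, Matrix.mul_assoc]
    _ = 0 := by rw [h3, sub_self]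

/-- Optimality of `M_opt`: for `a`, `a'` arbitrary, the weighted product of `a` with the optimal
preimage of `Fᵀ a'` depends on `Fᵀ a` only and is given by `Q̄₀`. -/
theorem dotProduct_inv_pinv_sub_Mopt {Q₀ : Matrix (Fin m) (Fin m) ℝ} (hQ₀ : Q₀.PosDef)
    (a b a' : Fin m → ℝ) (hab : Fᵀ *ᵥ a = Fᵀ *ᵥ b) :
    a ⬝ᵥ (Q₀⁻¹ *ᵥ ((pinv Fᵀ - Mopt F Q₀) *ᵥ (Fᵀ *ᵥ a'))) = b ⬝ᵥ (Qbar F Q₀ *ᵥ a') := by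
  set N := pinv Fᵀ - Mopt F Q₀ with hN
  have key : ∀ c, Fᵀ *ᵥ c = 0 → c ⬝ᵥ (Q₀⁻¹ *ᵥ (N *ᵥ (Fᵀ *ᵥ a'))) = 0 := by
    intro c hc
    rw [← kerProj_mulVec_of_mem F hc, mulVec_dotProduct_eq, kerProj_transpose, mulVec_mulVec,
      mulVec_mulVec, kerProj_mul_inv_mul_pinv_sub_Mopt hQ₀, zero_mulVec, dotProduct_zero]
  -- Both `a` and the optimal preimage of `Fᵀb` are preimages of the same vector, so their
  -- difference is in `ker Fᵀ`.
  have h1 := key (a - N *ᵥ (Fᵀ *ᵥ b)) (by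
    rw [mulVec_sub, transpose_mulVec_pinv_sub_Mopt, hab, sub_self])
  rw [sub_dotProduct, sub_eq_zero] at h1
  rw [h1, mulVec_dotProduct_eq, mulVec_dotProduct_eq, transpose_transpose, Qbar, ← hN]
  simp only [mulVec_mulVec, Matrix.mul_assoc]

end Pinv

/-! ### The gain -/

section Gain

variable {m p r k : ℕ} {S : LTI m p r k} {Q : Matrix (Fin m) (Fin m) ℝ}
  {R : Matrix (Fin p) (Fin p) ℝ}

theorem weighted_input_posDef (hQ : Q.PosDef) (hR : R.PosDef) (h : S.D.rank = k) :
    (S.Dᵀ * weight Q R * S.D).PosDef := by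
  have := (weight_posDef hQ hR).conjTranspose_mul_mul_same (mulVec_injective_of_rank_eq h)
  rwa [conjTranspose_eq_transpose_of_trivial] at this

/-- The defining relation of the gain. -/
theorem weighted_input_mul_gain (hQ : Q.PosDef) (hR : R.PosDef)
    (h : (k = 1 ∧ S.D = 0 ∧ S.B = 0) ∨ S.D.rank = k) (P : Matrix (Fin r) (Fin r) ℝ) :
    (S.Dᵀ * weight Q R * S.D) * gain S Q R P = S.Bᵀ * P + S.Dᵀ * weight Q R * S.C := by
  by_cases hD : S.D = 0
  -- If `S.D = 0`, the full-rank alternative forces `k = 0`, and `S.B` has no columns.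
  · have hB : S.B = 0 := by
      rcases h with h | h
      · exact h.2.2
      · rw [hD, rank_zero] at h
        subst h
        ext i j
        exact j.elim0
    simp [hD, hB]
  · have hr := h.resolve_left fun h => hD h.2.1
    rw [gain, if_pos hD, ← Matrix.mul_assoc, mul_nonsing_inv _
      ((isUnit_iff_isUnit_det _).1 (weighted_input_posDef hQ hR hr).isUnit), Matrix.one_mul]

theorem gain_transpose_mul_weighted_input (hQ : Q.PosDef) (hR : R.PosDef)
    (h : (k = 1 ∧ S.D = 0 ∧ S.B = 0) ∨ S.D.rank = k) {P : Matrix (Fin r) (Fin r) ℝ} (hP : Pᵀ = P) :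
    (gain S Q R P)ᵀ * (S.Dᵀ * weight Q R * S.D) = P * S.B + S.Cᵀ * weight Q R * S.D := by
  have := congrArg transpose (weighted_input_mul_gain hQ hR h P)
  simpa only [transpose_mul, transpose_add, transpose_transpose, hP,
    (weight_posDef hQ hR).transpose_eq, Matrix.mul_assoc] using this

end Gain

/-! ### Riccati differential equations -/

theorem HasDerivWithinAt.dotProduct {ι : Type*} [Fintype ι] {f g : ℝ → ι → ℝ} {f' g' : ι → ℝ}
    {s : Set ℝ} {t : ℝ} (hf : HasDerivWithinAt f f' s t) (hg : HasDerivWithinAt g g' s t) :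
    HasDerivWithinAt (fun s => f s ⬝ᵥ g s) (f' ⬝ᵥ g t + f t ⬝ᵥ g') s t := by
  have := HasDerivWithinAt.fun_sum (u := Finset.univ) fun i _ =>
    (hasDerivWithinAt_pi.1 hf i).fun_mul (hasDerivWithinAt_pi.1 hg i)
  simpa [_root_.dotProduct, Finset.sum_add_distrib] using this

theorem HasDerivWithinAt.mulVec_of_entries {ι κ : Type*} [Fintype ι] [Fintype κ]
    {M : ℝ → Matrix ι κ ℝ} {M' : Matrix ι κ ℝ} {w : ℝ → κ → ℝ} {w' : κ → ℝ} {s : Set ℝ} {t : ℝ}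
    (hM : ∀ i j, HasDerivWithinAt (fun s => M s i j) (M' i j) s t)
    (hw : HasDerivWithinAt w w' s t) :
    HasDerivWithinAt (fun s => M s *ᵥ w s) (M' *ᵥ w t + M t *ᵥ w') s t :=
  hasDerivWithinAt_pi.2 fun i => (hasDerivWithinAt_pi.2 (hM i)).dotProduct hw

theorem HasDerivWithinAt.comp_sub_left {E : Type*} [NormedAddCommGroup E] [NormedSpace ℝ E]
    {f : ℝ → E} {f' : E} {T t : ℝ} (h : HasDerivWithinAt f f' (Icc 0 T) (T - t)) :
    HasDerivWithinAt (fun s => f (T - s)) (-f') (Icc 0 T) t := by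
  have h1 : HasDerivWithinAt (fun s : ℝ => T - s) (-1) (Icc 0 T) t :=
    ((hasDerivAt_id t).const_sub T).hasDerivWithinAt
  have := h.scomp t h1 (fun s hs => ⟨by linarith [hs.2], by linarith [hs.1]⟩)
  rw [neg_one_smul] at this
  exact this

theorem continuousOn_comp_sub_left {E : Type*} [TopologicalSpace E] {f : ℝ → E} {T : ℝ}
    (h : ContinuousOn f (Icc 0 T)) : ContinuousOn (fun s => f (T - s)) (Icc 0 T) :=
  h.comp (by fun_prop) fun s hs => ⟨by linarith [hs.2], by linarith [hs.1]⟩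

/-- Derivative of a bilinear form `v · X(T - s) w` along trajectories of `v' = G(T - s) v`, where
`X` solves the Lyapunov equation `X' = Gᵀ X + X G + N`. -/
theorem hasDerivWithinAt_lyapunov {ι : Type*} [Fintype ι] {X N G : ℝ → Matrix ι ι ℝ} {T : ℝ}
    (hX : ∀ t ∈ Icc 0 T, ∀ i j, HasDerivWithinAt (fun s => X s i j)
      (((G t)ᵀ * X t + X t * G t + N t) i j) (Icc 0 T) t) {v w : ℝ → ι → ℝ} {s : ℝ}
    (hs : s ∈ Icc 0 T) (hv : HasDerivWithinAt v (G (T - s) *ᵥ v s) (Icc 0 T) s)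
    (hw : HasDerivWithinAt w (G (T - s) *ᵥ w s) (Icc 0 T) s) :
    HasDerivWithinAt (fun s => v s ⬝ᵥ (X (T - s) *ᵥ w s)) (-(v s ⬝ᵥ (N (T - s) *ᵥ w s)))
      (Icc 0 T) s := by
  have hX' := fun i j => (hX (T - s) ⟨by linarith [hs.2], by linarith [hs.1]⟩ i j).comp_sub_left
  have := hv.dotProduct (HasDerivWithinAt.mulVec_of_entries
    (M' := -((G (T - s))ᵀ * X (T - s) + X (T - s) * G (T - s) + N (T - s))) hX' hw)
  convert this using 1
  simp only [neg_mulVec, add_mulVec, dotProduct_add, dotProduct_neg, mulVec_dotProduct_eq,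
    mulVec_mulVec]
  ring

theorem exists_linear_flow {ι : Type*} [Fintype ι] {G : ℝ → Matrix ι ι ℝ} {T : ℝ} (hT : 0 ≤ T)
    (hG : ContinuousOn G (Icc 0 T)) (v₀ : ι → ℝ) :
    ∃ v : ℝ → ι → ℝ, v 0 = v₀ ∧
      ∀ s ∈ Icc 0 T, HasDerivWithinAt v (G (T - s) *ᵥ v s) (Icc 0 T) s := by
  obtain ⟨v, h0, hv⟩ := exists_affine_ode_solution hT (continuousOn_comp_sub_left hG)
    (continuousOn_const (c := (0 : ι → ℝ))) v₀
  exact ⟨v, h0, fun s hs => by simpa using hv s hs⟩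

theorem lyapunov_mono {ι : Type*} {X N G : ℝ → Matrix ι ι ℝ} [Fintype ι] {T t : ℝ} (ht : t ≤ T)
    (hX : ∀ t ∈ Icc 0 T, ∀ i j, HasDerivWithinAt (fun s => X s i j)
      (((G t)ᵀ * X t + X t * G t + N t) i j) (Icc 0 T) t) :
    ∀ s ∈ Icc 0 t, ∀ i j, HasDerivWithinAt (fun s => X s i j)
      (((G s)ᵀ * X s + X s * G s + N s) i j) (Icc 0 t) s :=
  fun s hs i j => (hX s ⟨hs.1, hs.2.trans ht⟩ i j).mono (Icc_subset_Icc_right ht)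

/-- Solutions of Lyapunov equations with nonnegative data are nonnegative. -/
theorem lyapunov_nonneg {ι : Type*} [Fintype ι] {X N G : ℝ → Matrix ι ι ℝ} {T : ℝ}
    (hG : ContinuousOn G (Icc 0 T))
    (hX : ∀ t ∈ Icc 0 T, ∀ i j, HasDerivWithinAt (fun s => X s i j)
      (((G t)ᵀ * X t + X t * G t + N t) i j) (Icc 0 T) t)
    (hN : ∀ t ∈ Icc 0 T, ∀ v, 0 ≤ v ⬝ᵥ (N t *ᵥ v)) (h0 : ∀ v, 0 ≤ v ⬝ᵥ (X 0 *ᵥ v)) :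
    ∀ t ∈ Icc 0 T, ∀ v, 0 ≤ v ⬝ᵥ (X t *ᵥ v) := by
  intro t ht v₀
  -- Along this flow `v(s)ᵀ X(t - s) v(s)` is nonincreasing. It starts at `v₀ᵀ X(t) v₀` and ends at
  -- a value of the form of `X 0`, which is nonnegative.
  obtain ⟨v, hv0, hv⟩ := exists_linear_flow ht.1 (hG.mono (Icc_subset_Icc_right ht.2)) v₀
  have hd := fun s (hs : s ∈ Icc 0 t) =>
    hasDerivWithinAt_lyapunov (lyapunov_mono ht.2 hX) hs (hv s hs) (hv s hs)
  have hanti : AntitoneOn (fun s => v s ⬝ᵥ (X (t - s) *ᵥ v s)) (Icc 0 t) := by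
    refine antitoneOn_of_hasDerivWithinAt_nonpos (convex_Icc 0 t)
      (fun s hs => (hd s hs).continuousWithinAt)
      (fun s hs => (hd s (interior_subset hs)).mono interior_subset) fun s hs => ?_
    have hs' := interior_subset hs
    rw [neg_nonpos]
    exact hN _ ⟨by linarith [hs'.2], by linarith [hs'.1, ht.2]⟩ _
  have h := hanti ⟨le_rfl, ht.1⟩ ⟨ht.1, le_rfl⟩ ht.1
  simp only [sub_self, sub_zero, hv0] at h
  exact (h0 _).trans h

/-- The homogeneous Lyapunov equation with zero initial value has only the zero solution. -/
theorem lyapunov_eq_zero {ι : Type*} [Fintype ι] {X G : ℝ → Matrix ι ι ℝ} {T : ℝ}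
    (hG : ContinuousOn G (Icc 0 T))
    (hX : ∀ t ∈ Icc 0 T, ∀ i j, HasDerivWithinAt (fun s => X s i j)
      (((G t)ᵀ * X t + X t * G t) i j) (Icc 0 T) t)
    (h0 : X 0 = 0) : ∀ t ∈ Icc 0 T, X t = 0 := by
  classical
  intro t ht
  have hX' : ∀ t ∈ Icc 0 T, ∀ i j, HasDerivWithinAt (fun s => X s i j)
      (((G t)ᵀ * X t + X t * G t + 0) i j) (Icc 0 T) t := by simpa using hX
  ext i j
  -- Flows issuing from two basis vectors make the conserved bilinear form equal to `X t i j` at `s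
  -- = 0`, and to zero at `s = t`.
  obtain ⟨v, hv0, hv⟩ := exists_linear_flow ht.1 (hG.mono (Icc_subset_Icc_right ht.2))
    (Pi.single i 1)
  obtain ⟨w, hw0, hw⟩ := exists_linear_flow ht.1 (hG.mono (Icc_subset_Icc_right ht.2))
    (Pi.single j 1)
  have hd := fun s (hs : s ∈ Icc 0 t) =>
    hasDerivWithinAt_lyapunov (N := fun _ => 0) (lyapunov_mono ht.2 hX') hs (hv s hs) (hw s hs)
  simp only [zero_mulVec, dotProduct_zero, neg_zero] at hd
  have := constant_of_has_deriv_right_zero (fun s hs => (hd s hs).continuousWithinAt)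
    (fun s hs => (hd s (Ico_subset_Icc_self hs)).Ici_of_Icc hs) t ⟨ht.1, le_rfl⟩
  simpa [hv0, hw0, h0] using this.symm

theorem continuousOn_matrix {ι κ : Type*} {M : ℝ → Matrix ι κ ℝ} {s : Set ℝ}
    (h : ∀ i j, ContinuousOn (fun t => M t i j) s) : ContinuousOn M s :=
  continuousOn_pi.2 fun i => continuousOn_pi.2 fun j => h i j

theorem ContinuousOn.matrix_mul' {ι κ ν : Type*} [Fintype κ] {M : ℝ → Matrix ι κ ℝ}
    {N : ℝ → Matrix κ ν ℝ} {s : Set ℝ} (hM : ContinuousOn M s) (hN : ContinuousOn N s) :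
    ContinuousOn (fun t => M t * N t) s := by
  rw [continuousOn_iff_continuous_domRestrict] at *
  exact hM.matrix_mul hN

/-- Testing the form on `e_i ± e_j` gives `2|P i j| ≤ P i i + P j j`, and each diagonal entry is at
most the trace. A bound on the trace thus bounds the whole Riccati solution. -/
theorem abs_apply_le_trace {ι : Type*} [Fintype ι] {P : Matrix ι ι ℝ} (hs : Pᵀ = P)
    (hP : ∀ v, 0 ≤ v ⬝ᵥ (P *ᵥ v)) (i j : ι) : |P i j| ≤ P.trace := by
  classical
  have hd : ∀ i, 0 ≤ P i i := fun i => by simpa using hP (Pi.single i 1)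
  have hle : ∀ i, P i i ≤ P.trace := fun i =>
    Finset.single_le_sum (f := fun i => P i i) (fun i _ => hd i) (Finset.mem_univ i)
  have hji : P j i = P i j := congrFun (congrFun hs i) j
  have h1 := hP (Pi.single i 1 + Pi.single j 1)
  have h2 := hP (Pi.single i 1 - Pi.single j 1)
  simp [mulVec_add, mulVec_sub] at h1 h2
  rw [abs_le]
  constructor <;> linarith [hle i, hle j, hd i, hd j]

section Riccati

variable {m n p r k : ℕ} {S : LTI m p r k} {F : Matrix (Fin m) (Fin n) ℝ}
  {Q₀ Q : Matrix (Fin m) (Fin m) ℝ} {R : Matrix (Fin p) (Fin p) ℝ} {T : ℝ}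
  {P : ℝ → Matrix (Fin r) (Fin r) ℝ}

theorem Qbar_transpose (hQ₀ : Q₀.PosDef) : (Qbar F Q₀)ᵀ = Qbar F Q₀ := by
  simp only [Qbar, transpose_mul, transpose_transpose, hQ₀.inv.transpose_eq, Matrix.mul_assoc]

theorem Qbar_nonneg (hQ₀ : Q₀.PosDef) (v : Fin m → ℝ) : 0 ≤ v ⬝ᵥ (Qbar F Q₀ *ᵥ v) := by
  have := hQ₀.inv.dotProduct_nonneg ((pinv Fᵀ - Mopt F Q₀) *ᵥ (Fᵀ *ᵥ v))
  rw [mulVec_dotProduct_eq, mulVec_dotProduct_eq, transpose_transpose] at this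
  simpa only [Qbar, mulVec_mulVec, Matrix.mul_assoc] using this

theorem IsRiccatiSolution.continuousOn (hP : IsRiccatiSolution S F Q₀ Q R T P) :
    ContinuousOn P (Icc 0 T) :=
  continuousOn_matrix fun i j t ht => (hP.deriv t ht i j).continuousWithinAt

theorem continuousOn_gain (hP : ContinuousOn P (Icc 0 T)) :
    ContinuousOn (fun t => gain S Q R (P t)) (Icc 0 T) := by
  by_cases hD : S.D = 0
  · simp only [gain, hD, ne_eq, not_true_eq_false, if_false]
    exact continuousOn_const
  · simp only [gain, ne_eq, hD, not_false_eq_true, if_true]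
    exact continuousOn_const.matrix_mul' ((continuousOn_const.matrix_mul' hP).add continuousOn_const)

/-- The quadratic term `Kᵀ(DᵀWD)K` is symmetric for every gain, so it drops out of the equation for
`Pᵀ - P`, which is homogeneous Lyapunov with zero initial value. -/
theorem IsRiccatiSolution.transpose_eq (hQ₀ : Q₀.PosDef) (hQ : Q.PosDef) (hR : R.PosDef)
    (hP : IsRiccatiSolution S F Q₀ Q R T P) : ∀ t ∈ Icc 0 T, (P t)ᵀ = P t := by
  have hW := (weight_posDef hQ hR).transpose_eq
  have key := lyapunov_eq_zero (X := fun t => (P t)ᵀ - P t) (G := fun _ => S.A) (T := T)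
    continuousOn_const ?_ ?_
  · intro t ht
    exact sub_eq_zero.1 (key t ht)
  · intro t ht i j
    have := (hP.deriv t ht j i).sub (hP.deriv t ht i j)
    set K := gain S Q R (P t)
    have e : (S.Aᵀ * P t + P t * S.A - Kᵀ * (S.Dᵀ * weight Q R * S.D) * K
        + S.Cᵀ * weight Q R * S.C)ᵀ - (S.Aᵀ * P t + P t * S.A
        - Kᵀ * (S.Dᵀ * weight Q R * S.D) * K + S.Cᵀ * weight Q R * S.C)
        = S.Aᵀ * ((P t)ᵀ - P t) + ((P t)ᵀ - P t) * S.A := ?_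
    · exact this.congr_deriv (congrFun (congrFun e i) j)
    simp only [transpose_add, transpose_sub, transpose_mul, transpose_transpose, hW,
      Matrix.mul_sub, Matrix.sub_mul, Matrix.mul_assoc]
    abel
  · simp only [hP.init, transpose_mul, transpose_transpose, Qbar_transpose hQ₀, Matrix.mul_assoc,
      sub_self]

/-- The Riccati right-hand side in Lyapunov form. -/
theorem riccati_rhs_eq_lyapunov (hQ : Q.PosDef) (hR : R.PosDef)
    (h : (k = 1 ∧ S.D = 0 ∧ S.B = 0) ∨ S.D.rank = k) {P : Matrix (Fin r) (Fin r) ℝ} (hP : Pᵀ = P) :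
    S.Aᵀ * P + P * S.A - (gain S Q R P)ᵀ * (S.Dᵀ * weight Q R * S.D) * gain S Q R P
      + S.Cᵀ * weight Q R * S.C =
    (S.A - S.B * gain S Q R P)ᵀ * P + P * (S.A - S.B * gain S Q R P)
      + (S.C - S.D * gain S Q R P)ᵀ * weight Q R * (S.C - S.D * gain S Q R P) := by
  have h1 := weighted_input_mul_gain hQ hR h P
  have h2 := gain_transpose_mul_weighted_input hQ hR h hP
  set K := gain S Q R P
  set W := weight Q R
  -- Completion of the square: the defining relation of the gain and its transpose each trade the
  -- quadratic term for a cross term.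
  have e1 : Kᵀ * (S.Dᵀ * W * S.D) * K = Kᵀ * S.Bᵀ * P + Kᵀ * S.Dᵀ * W * S.C := by
    rw [Matrix.mul_assoc, h1, Matrix.mul_add]
    simp only [Matrix.mul_assoc]
  have e2 : Kᵀ * (S.Dᵀ * W * S.D) * K = P * S.B * K + S.Cᵀ * W * S.D * K := by
    rw [h2, Matrix.add_mul]
  have e3 : (S.C - S.D * K)ᵀ * W * (S.C - S.D * K) = S.Cᵀ * W * S.C - Kᵀ * S.Dᵀ * W * S.C
      - S.Cᵀ * W * S.D * K + Kᵀ * (S.Dᵀ * W * S.D) * K := by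
    simp only [transpose_sub, transpose_mul, Matrix.sub_mul, Matrix.mul_sub, Matrix.mul_assoc]
    abel
  have e4 : Kᵀ * S.Dᵀ * W * S.C = Kᵀ * (S.Dᵀ * W * S.D) * K - Kᵀ * S.Bᵀ * P := by
    rw [e1]; abel
  have e5 : S.Cᵀ * W * S.D * K = Kᵀ * (S.Dᵀ * W * S.D) * K - P * S.B * K := by
    rw [e2]; abel
  rw [e3, e4, e5]
  simp only [transpose_sub, transpose_mul, Matrix.sub_mul, Matrix.mul_sub, Matrix.mul_assoc]
  abel

/-- In Lyapunov form, with the closed-loop matrix `A - BK`, the source is `(C - DK)ᵀW(C - DK) ≥ 0`,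
and the initial value inherits nonnegativity from `Qbar`. -/
theorem IsRiccatiSolution.nonneg (hQ₀ : Q₀.PosDef) (hQ : Q.PosDef) (hR : R.PosDef)
    (h : (k = 1 ∧ S.D = 0 ∧ S.B = 0) ∨ S.D.rank = k)
    (hP : IsRiccatiSolution S F Q₀ Q R T P) : ∀ t ∈ Icc 0 T, ∀ v, 0 ≤ v ⬝ᵥ (P t *ᵥ v) := by
  refine lyapunov_nonneg (G := fun t => S.A - S.B * gain S Q R (P t))
    (N := fun t => (S.C - S.D * gain S Q R (P t))ᵀ * weight Q R * (S.C - S.D * gain S Q R (P t)))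
    (continuousOn_const.sub (continuousOn_const.matrix_mul' (continuousOn_gain hP.continuousOn)))
    ?_ ?_ ?_
  · intro t ht i j
    rw [← riccati_rhs_eq_lyapunov hQ hR h (hP.transpose_eq hQ₀ hQ hR t ht)]
    exact hP.deriv t ht i j
  · intro t ht v
    have := (weight_posDef hQ hR).dotProduct_nonneg ((S.C - S.D * gain S Q R (P t)) *ᵥ v)
    simpa only [mulVec_dotProduct_eq, mulVec_mulVec, Matrix.mul_assoc] using this
  · intro v
    have := Qbar_nonneg (F := F) hQ₀ (S.Cs *ᵥ v)
    simpa only [hP.init, mulVec_dotProduct_eq, mulVec_mulVec, Matrix.mul_assoc] using this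

theorem trace_mul_le {ι : Type*} [Fintype ι] {P : Matrix ι ι ℝ} {c : ℝ} (A : Matrix ι ι ℝ)
    (hP : ∀ i j, |P i j| ≤ c) : (P * A).trace ≤ (∑ i, ∑ j, |A i j|) * c := by
  have : (P * A).trace = ∑ i, ∑ j, A i j * P j i := by
    rw [trace_mul_comm]; rfl
  rw [this, Finset.sum_mul]
  refine Finset.sum_le_sum fun i _ => ?_
  rw [Finset.sum_mul]
  refine Finset.sum_le_sum fun j _ => (le_abs_self _).trans ?_
  rw [abs_mul]
  gcongr
  exact hP j i

theorem trace_nonneg_of_forall {ι : Type*} [Fintype ι] {M : Matrix ι ι ℝ}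
    (h : ∀ v, 0 ≤ v ⬝ᵥ (M *ᵥ v)) : 0 ≤ M.trace := by
  classical
  exact Finset.sum_nonneg fun i _ => by simpa using h (Pi.single i 1)

/-- A priori bound for solutions of the Riccati equation. -/
theorem IsRiccatiSolution.trace_le (hQ₀ : Q₀.PosDef) (hQ : Q.PosDef) (hR : R.PosDef)
    (h : (k = 1 ∧ S.D = 0 ∧ S.B = 0) ∨ S.D.rank = k)
    (hP : IsRiccatiSolution S F Q₀ Q R T P) : ∀ t ∈ Icc 0 T, (P t).trace ≤
      gronwallBound (S.Csᵀ * Qbar F Q₀ * S.Cs).trace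
        (2 * ∑ i, ∑ j, |S.A i j|) (S.Cᵀ * weight Q R * S.C).trace t := by
  have hd : ∀ t ∈ Icc 0 T, HasDerivWithinAt (fun t => (P t).trace) _ (Icc 0 T) t :=
    fun t ht => HasDerivWithinAt.fun_sum fun i _ => hP.deriv t ht i i
  have key := le_gronwallBound_of_liminf_deriv_right_le
    (fun t ht => (hd t ht).continuousWithinAt)
    (fun t ht c hc => ((hd t (Ico_subset_Icc_self ht)).Ici_of_Icc ht).liminf_right_slope_le hc)
    (δ := (S.Csᵀ * Qbar F Q₀ * S.Cs).trace) (by rw [hP.init])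
    (K := 2 * ∑ i, ∑ j, |S.A i j|) (ε := (S.Cᵀ * weight Q R * S.C).trace) ?_
  · simpa using key
  · intro t ht
    have ht' := Ico_subset_Icc_self ht
    have hs := hP.transpose_eq hQ₀ hQ hR t ht'
    have hb := abs_apply_le_trace hs (hP.nonneg hQ₀ hQ hR h t ht')
    change (_ : Matrix _ _ ℝ).trace ≤ _
    rw [trace_add, trace_sub, trace_add]
    have e : (S.Aᵀ * P t).trace = (P t * S.A).trace := by
      rw [← trace_transpose, transpose_mul, transpose_transpose, hs]
    have h1 := trace_mul_le S.A hb
    -- The quadratic term enters with a minus sign and has nonnegative trace. Discarding it leaves a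
    -- linear differential inequality for the trace.
    have h2 : 0 ≤ ((gain S Q R (P t))ᵀ * (S.Dᵀ * weight Q R * S.D) * gain S Q R (P t)).trace := by
      refine trace_nonneg_of_forall fun v => ?_
      have := (weight_posDef hQ hR).dotProduct_nonneg (S.D *ᵥ (gain S Q R (P t) *ᵥ v))
      simpa only [transpose_mul, mulVec_dotProduct_eq, mulVec_mulVec, Matrix.mul_assoc] using this
    rw [e]
    linarith

theorem contDiff_matrix_mul {E ι κ ν : Type*} [NormedAddCommGroup E] [NormedSpace ℝ E] [Fintype κ]
    {M : E → Matrix ι κ ℝ} {N : E → Matrix κ ν ℝ} (hM : ∀ i j, ContDiff ℝ 1 fun x => M x i j)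
    (hN : ∀ i j, ContDiff ℝ 1 fun x => N x i j) (i : ι) (j : ν) :
    ContDiff ℝ 1 fun x => (M x * N x) i j := by
  simp only [mul_apply]
  exact ContDiff.sum fun l _ => (hM i l).mul (hN l j)

/-- Continuous differentiability supplies the Lipschitz constant on a ball that the global existence
theorem needs. With matrices encoded as functions of index pairs, the sup norm is the largest entry
in absolute value, the quantity that the trace bounds. -/
theorem contDiff_riccati_rhs (S : LTI m p r k) (Q : Matrix (Fin m) (Fin m) ℝ)
    (R : Matrix (Fin p) (Fin p) ℝ) (i j : Fin r) :
    ContDiff ℝ 1 fun x : Fin r × Fin r → ℝ =>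
      (S.Aᵀ * (of fun i j => x (i, j)) + (of fun i j => x (i, j)) * S.A
      - (gain S Q R (of fun i j => x (i, j)))ᵀ * (S.Dᵀ * weight Q R * S.D)
        * gain S Q R (of fun i j => x (i, j))
      + S.Cᵀ * weight Q R * S.C) i j := by
  have hx : ∀ i j, ContDiff ℝ 1 fun x : Fin r × Fin r → ℝ =>
      (of fun i j => x (i, j) : Matrix (Fin r) (Fin r) ℝ) i j := fun i j => contDiff_apply ℝ ℝ (i, j)
  have hg : ∀ i j, ContDiff ℝ 1 fun x : Fin r × Fin r → ℝ =>
      gain S Q R (of fun i j => x (i, j)) i j := by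
    intro i j
    by_cases hD : S.D = 0
    · simp only [gain, hD, ne_eq, not_true_eq_false, if_false]
      exact contDiff_const
    · simp only [gain, ne_eq, hD, not_false_eq_true, if_true]
      refine contDiff_matrix_mul (M := fun _ => (S.Dᵀ * weight Q R * S.D)⁻¹)
        (fun _ _ => contDiff_const) (fun i j => ?_) i j
      exact (contDiff_matrix_mul (M := fun _ => S.Bᵀ) (fun _ _ => contDiff_const) hx i j).add
        contDiff_const
  simp only [Matrix.add_apply, Matrix.sub_apply]
  refine (((contDiff_matrix_mul (M := fun _ => S.Aᵀ) (fun _ _ => contDiff_const) hx i j).add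
    (contDiff_matrix_mul (N := fun _ => S.A) hx (fun _ _ => contDiff_const) i j)).sub ?_).add
    contDiff_const
  exact contDiff_matrix_mul (contDiff_matrix_mul (M := fun x => (gain S Q R _)ᵀ)
    (N := fun _ => S.Dᵀ * weight Q R * S.D) (fun i j => hg j i) fun _ _ => contDiff_const) hg i j

/-- Global existence for the Riccati equation. -/
theorem exists_isRiccatiSolution (S : LTI m p r k) (F : Matrix (Fin m) (Fin n) ℝ)
    (hQ₀ : Q₀.PosDef) (hQ : Q.PosDef) (hR : R.PosDef)
    (h : (k = 1 ∧ S.D = 0 ∧ S.B = 0) ∨ S.D.rank = k) (hT : 0 ≤ T) :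
    ∃ P, IsRiccatiSolution S F Q₀ Q R T P := by
  set f : (Fin r × Fin r → ℝ) → Fin r × Fin r → ℝ := fun x ij =>
      (S.Aᵀ * (of fun i j => x (i, j)) + (of fun i j => x (i, j)) * S.A
      - (gain S Q R (of fun i j => x (i, j)))ᵀ * (S.Dᵀ * weight Q R * S.D)
        * gain S Q R (of fun i j => x (i, j))
      + S.Cᵀ * weight Q R * S.C) ij.1 ij.2 with hf
  have hfC : ContDiff ℝ 1 f := contDiff_pi.2 fun ij => contDiff_riccati_rhs S Q R ij.1 ij.2
  set P₀ := S.Csᵀ * Qbar F Q₀ * S.Cs with hP₀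
  -- The trace bound at the final time `T`; it dominates every entry of every solution on a shorter
  -- interval `[0, τ]`.
  set R₀ := gronwallBound P₀.trace (2 * ∑ i, ∑ j, |S.A i j|) (S.Cᵀ * weight Q R * S.C).trace T
  obtain ⟨K, hK⟩ := hfC.contDiffOn.exists_lipschitzOnWith (by decide)
    (convex_closedBall (0 : Fin r × Fin r → ℝ) (R₀ + 1)) (isCompact_closedBall _ _)
  have hsol : ∀ τ, ∀ x : ℝ → Fin r × Fin r → ℝ, x 0 = (fun ij => P₀ ij.1 ij.2) →
      (∀ t ∈ Icc 0 τ, HasDerivWithinAt x (f (x t)) (Icc 0 τ) t) →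
      IsRiccatiSolution S F Q₀ Q R τ (fun t => of fun i j => x t (i, j)) := by
    intro τ x hx0 hx
    refine ⟨?_, fun t ht i j => hasDerivWithinAt_pi.1 (hx t ht) (i, j)⟩
    ext i j
    simp [hx0, hP₀]
  have htr : 0 ≤ P₀.trace := by
    refine trace_nonneg_of_forall fun v => ?_
    have := Qbar_nonneg (F := F) hQ₀ (S.Cs *ᵥ v)
    simpa only [hP₀, mulVec_dotProduct_eq, mulVec_mulVec, Matrix.mul_assoc] using this
  have htr2 : 0 ≤ (S.Cᵀ * weight Q R * S.C).trace := by
    refine trace_nonneg_of_forall fun v => ?_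
    have := (weight_posDef hQ hR).dotProduct_nonneg (S.C *ᵥ v)
    simpa only [mulVec_dotProduct_eq, mulVec_mulVec, Matrix.mul_assoc] using this
  have hbound : ∀ τ ∈ Icc 0 T, ∀ x : ℝ → Fin r × Fin r → ℝ, x 0 = (fun ij => P₀ ij.1 ij.2) →
      (∀ t ∈ Icc 0 τ, HasDerivWithinAt x (f (x t)) (Icc 0 τ) t) → ‖x τ‖ ≤ R₀ := by
    intro τ hτ x hx0 hx
    have hP := hsol τ x hx0 hx
    have hτ' : τ ∈ Icc 0 τ := ⟨hτ.1, le_rfl⟩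
    have hb := (hP.trace_le hQ₀ hQ hR h τ hτ').trans
      (gronwallBound_mono htr htr2 (by positivity) hτ.2)
    have ha := abs_apply_le_trace (hP.transpose_eq hQ₀ hQ hR τ hτ') (hP.nonneg hQ₀ hQ hR h τ hτ')
    rw [pi_norm_le_iff_of_nonneg
      ((trace_nonneg_of_forall (hP.nonneg hQ₀ hQ hR h τ hτ')).trans hb)]
    exact fun ij => (ha ij.1 ij.2).trans hb
  obtain ⟨x, hx0, hx⟩ := exists_ode_solution_of_bound (f := fun _ => f) hT
    (fun ij => P₀ ij.1 ij.2) R₀ K (fun _ _ => hK) (fun _ => continuousOn_const) hbound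
  exact ⟨_, hsol T x hx0 hx⟩

end Riccati

/-! ### Linear-quadratic control -/

theorem MeasureTheory.MemLp.continuousOn_mulVec {ι κ : Type*} [Fintype ι] [Fintype κ]
    {M : ℝ → Matrix ι κ ℝ} {y : ℝ → κ → ℝ} {a b : ℝ} {q : ENNReal}
    (hy : MemLp y q (volume.restrict (Icc a b))) (hM : ContinuousOn M (Icc a b)) :
    MemLp (fun t => M t *ᵥ y t) q (volume.restrict (Icc a b)) := by
  obtain ⟨C, hC⟩ := exists_norm_mulVec_le hM
  refine hy.of_le_mul (c := C) ?_ ?_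
  · refine (aemeasurable_pi_lambda _ fun i => ?_).aestronglyMeasurable
    refine Finset.aemeasurable_fun_sum _ fun j _ => AEMeasurable.mul ?_ ?_
    · exact (continuousOn_pi.1 (continuousOn_pi.1 hM i) j).aemeasurable measurableSet_Icc
    · exact (aemeasurable_pi_iff.1 hy.aestronglyMeasurable.aemeasurable) j
  · rw [ae_restrict_iff' measurableSet_Icc]
    exact Filter.Eventually.of_forall fun t ht => hC t ht _

theorem ContinuousOn.matrix_mulVec' {ι κ : Type*} [Fintype κ] {M : ℝ → Matrix ι κ ℝ}
    {v : ℝ → κ → ℝ} {s : Set ℝ} (hM : ContinuousOn M s) (hv : ContinuousOn v s) :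
    ContinuousOn (fun t => M t *ᵥ v t) s := by
  rw [continuousOn_iff_continuous_domRestrict] at *
  exact hM.matrix_mulVec hv

theorem ContinuousOn.matrix_transpose' {ι κ : Type*} {M : ℝ → Matrix ι κ ℝ} {s : Set ℝ}
    (hM : ContinuousOn M s) : ContinuousOn (fun t => (M t)ᵀ) s := by
  rw [continuousOn_iff_continuous_domRestrict] at *
  exact hM.matrix_transpose

theorem HasDerivAt.mulVec_of_entries {ι κ : Type*} [Fintype ι] [Fintype κ]
    {M : ℝ → Matrix ι κ ℝ} {M' : Matrix ι κ ℝ} {w : ℝ → κ → ℝ} {w' : κ → ℝ} {t : ℝ}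
    (hM : ∀ i j, HasDerivAt (fun s => M s i j) (M' i j) t) (hw : HasDerivAt w w' t) :
    HasDerivAt (fun s => M s *ᵥ w s) (M' *ᵥ w t + M t *ᵥ w') t :=
  hasDerivAt_pi.2 fun i => (hasDerivAt_pi.2 (hM i)).dotProduct hw

theorem memLp_one_of_two {E : Type*} [NormedAddCommGroup E] {f : ℝ → E} {a b : ℝ}
    (hf : MemLp f 2 (volume.restrict (Icc a b))) : IntegrableOn f (Icc a b) :=
  hf.integrable (by norm_num)

section LQ

variable {m n p r k : ℕ} {S : LTI m p r k} {F : Matrix (Fin m) (Fin n) ℝ}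
  {Q₀ Q : Matrix (Fin m) (Fin m) ℝ} {R : Matrix (Fin p) (Fin p) ℝ} {T : ℝ}
  {P : ℝ → Matrix (Fin r) (Fin r) ℝ}

theorem IsRiccatiSolution.absolutelyContinuous_apply (hP : IsRiccatiSolution S F Q₀ Q R T P)
    (hT : 0 ≤ T) (i j : Fin r) : AbsolutelyContinuousOnInterval (fun t => P t i j) 0 T := by
  refine absolutelyContinuousOnInterval_of_hasDerivWithinAt hT (fun t ht => hP.deriv t ht i j) ?_
  have hc := hP.continuousOn
  have hK := continuousOn_gain (S := S) (Q := Q) (R := R) hc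
  have : ContinuousOn (fun t => S.Aᵀ * P t + P t * S.A
      - (gain S Q R (P t))ᵀ * (S.Dᵀ * weight Q R * S.D) * gain S Q R (P t)
      + S.Cᵀ * weight Q R * S.C) (Icc 0 T) :=
    (((continuousOn_const.matrix_mul' hc).add (hc.matrix_mul' continuousOn_const)).sub
      ((hK.matrix_transpose'.matrix_mul' continuousOn_const).matrix_mul' hK)).add continuousOn_const
  exact continuousOn_pi.1 (continuousOn_pi.1 this i) j

/-- First-order optimality of the closed loop: the bilinear cost of an arbitrary trajectory and a
closed-loop trajectory is a boundary term. -/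
theorem IsRiccatiSolution.integral_cost (hQ₀ : Q₀.PosDef) (hQ : Q.PosDef) (hR : R.PosDef)
    (h : (k = 1 ∧ S.D = 0 ∧ S.B = 0) ∨ S.D.rank = k) (hT : 0 ≤ T)
    (hP : IsRiccatiSolution S F Q₀ Q R T P) {v v' : ℝ → Fin r → ℝ} {g : ℝ → Fin k → ℝ}
    (hv : AbsolutelyContinuousOnInterval v 0 T) (hv' : AbsolutelyContinuousOnInterval v' 0 T)
    (hdv : ∀ᵐ s ∂volume.restrict (Icc 0 T), HasDerivAt v (S.A *ᵥ v s + S.B *ᵥ g s) s)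
    (hdv' : ∀ᵐ s ∂volume.restrict (Icc 0 T),
      HasDerivAt v' ((S.A - S.B * gain S Q R (P (T - s))) *ᵥ v' s) s) :
    ∫ s in (0 : ℝ)..T, (S.C *ᵥ v s + S.D *ᵥ g s) ⬝ᵥ
        (weight Q R *ᵥ ((S.C - S.D * gain S Q R (P (T - s))) *ᵥ v' s)) =
      v 0 ⬝ᵥ (P T *ᵥ v' 0) - v T ⬝ᵥ (P 0 *ᵥ v' T) := by
  have hPac : ∀ i, AbsolutelyContinuousOnInterval (fun s => P (T - s) i) 0 T := fun i =>
    AbsolutelyContinuousOnInterval.comp_sub_left (f := fun t => P t i) hT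
      (absolutelyContinuousOnInterval_pi.2 fun j => hP.absolutelyContinuous_apply hT i j)
  have hp : AbsolutelyContinuousOnInterval (fun s => P (T - s) *ᵥ v' s) 0 T :=
    absolutelyContinuousOnInterval_pi.2 fun i => (hPac i).dotProduct hv'
  -- The cost density is minus the derivative of `v(s)ᵀ P(T - s) v'(s)`; what remains is to verify
  -- this almost everywhere.
  have key := (hv.dotProduct hp).integral_eq_sub_of_ae hT (f' := fun s =>
    -((S.C *ᵥ v s + S.D *ᵥ g s) ⬝ᵥ
        (weight Q R *ᵥ ((S.C - S.D * gain S Q R (P (T - s))) *ᵥ v' s)))) ?_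
  · rw [intervalIntegral.integral_neg] at key
    simp only [sub_self, sub_zero] at key
    linarith
  have hdP : ∀ᵐ s ∂volume.restrict (Icc 0 T), ∀ i j, HasDerivAt (fun s => P (T - s) i j) _ s :=
    ae_all_iff.2 fun i => ae_all_iff.2 fun j => ae_hasDerivAt_of_hasDerivWithinAt fun s hs =>
      (hP.deriv (T - s) ⟨by linarith [hs.2], by linarith [hs.1]⟩ i j).comp_sub_left
  filter_upwards [hdv, hdv', hdP, ae_restrict_mem measurableSet_Icc] with s h1 h2 h3 hs
  have hsym := hP.transpose_eq hQ₀ hQ hR (T - s) ⟨by linarith [hs.2], by linarith [hs.1]⟩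
  have hg := weighted_input_mul_gain hQ hR h (P (T - s))
  have hrhs := riccati_rhs_eq_lyapunov hQ hR h hsym
  have hder := h1.dotProduct (HasDerivAt.mulVec_of_entries
    (M := fun s => P (T - s)) (M' := -(_ : Matrix (Fin r) (Fin r) ℝ)) h3 h2)
  rw [hrhs] at hder
  refine hder.congr_deriv ?_
  set K := gain S Q R (P (T - s))
  set W := weight Q R
  set X := P (T - s)
  -- Stationarity in the input: `BᵀX + DᵀW(C - DK) = 0`. It cancels the contribution of the
  -- arbitrary input `g`, and likewise the feedback terms `K v` produced by the Lyapunov form.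
  have hB : S.Bᵀ * X = -(S.Dᵀ * W * (S.C - S.D * K)) := by
    rw [Matrix.mul_sub, ← Matrix.mul_assoc, hg]
    abel
  have e1 : ∀ a : Fin k → ℝ, (S.B *ᵥ a) ⬝ᵥ (X *ᵥ v' s) =
      -((S.D *ᵥ a) ⬝ᵥ (W *ᵥ ((S.C - S.D * K) *ᵥ v' s))) := by
    intro a
    rw [mulVec_dotProduct_eq, mulVec_dotProduct_eq, mulVec_mulVec, hB]
    simp only [mulVec_mulVec, neg_mulVec, dotProduct_neg, Matrix.mul_assoc]
  have e2 : v s ⬝ᵥ ((S.A - S.B * K)ᵀ *ᵥ (X *ᵥ v' s)) =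
      (S.A *ᵥ v s) ⬝ᵥ (X *ᵥ v' s) - (S.B *ᵥ (K *ᵥ v s)) ⬝ᵥ (X *ᵥ v' s) := by
    rw [← mulVec_dotProduct_eq, sub_mulVec, sub_dotProduct, ← mulVec_mulVec]
  have e3 : v s ⬝ᵥ ((S.C - S.D * K)ᵀ *ᵥ (W *ᵥ ((S.C - S.D * K) *ᵥ v' s))) =
      (S.C *ᵥ v s) ⬝ᵥ (W *ᵥ ((S.C - S.D * K) *ᵥ v' s))
      - (S.D *ᵥ (K *ᵥ v s)) ⬝ᵥ (W *ᵥ ((S.C - S.D * K) *ᵥ v' s)) := by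
    rw [← mulVec_dotProduct_eq, sub_mulVec, sub_dotProduct, ← mulVec_mulVec]
  rw [neg_mulVec, add_mulVec, add_mulVec, ← mulVec_mulVec, ← mulVec_mulVec _ X,
    ← mulVec_mulVec (v' s) _ (S.C - S.D * K), ← mulVec_mulVec _ _ W]
  simp only [dotProduct_add, dotProduct_neg, add_dotProduct, e2, e3, e1]
  ring

theorem exists_isClosedLoopState (hT : 0 ≤ T) (ℓ : Fin m → ℝ)
    (hP : IsRiccatiSolution S F Q₀ Q R T P) : ∃ v, IsClosedLoopState S F Q R ℓ T P v := by
  have hG : ContinuousOn (fun t => S.A - S.B * gain S Q R (P t)) (Icc 0 T) :=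
    continuousOn_const.sub (continuousOn_const.matrix_mul' (continuousOn_gain hP.continuousOn))
  obtain ⟨v, h0, hv⟩ := exists_linear_flow hT hG (S.stateMap F *ᵥ (Fᵀ *ᵥ ℓ))
  refine ⟨v, (acOn_Icc_iff hT).2 ?_, h0, ae_hasDerivAt_of_hasDerivWithinAt hv⟩
  exact absolutelyContinuousOnInterval_of_hasDerivWithinAt hT hv
    ((continuousOn_comp_sub_left hG).matrix_mulVec' fun s hs => (hv s hs).continuousWithinAt)

/-- The forcing is only square integrable because `y` is. Subtracting its primitive `b` leaves `ρ' =
Mρ + Mb`, an affine equation with continuous data, and the observer state is `ρ + b`. -/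
theorem exists_isObserverState (hT : 0 ≤ T) (hP : IsRiccatiSolution S F Q₀ Q R T P)
    {y : ℝ → Fin p → ℝ} (hy : L2Loc (Icc 0 T) y) : ∃ r', IsObserverState S Q R T P y r' := by
  have hK := continuousOn_gain (S := S) (Q := Q) (R := R) hP.continuousOn
  have hM : ContinuousOn (fun t => (S.A - S.B * gain S Q R (P t))ᵀ) (Icc 0 T) :=
    (continuousOn_const.sub (continuousOn_const.matrix_mul' hK)).matrix_transpose'
  have hN : ContinuousOn (fun t => (S.Cu - S.Du * gain S Q R (P t))ᵀ) (Icc 0 T) :=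
    (continuousOn_const.sub (continuousOn_const.matrix_mul' hK)).matrix_transpose'
  have hc := memLp_one_of_two ((l2Loc_Icc_iff.1 hy).continuousOn_mulVec hN)
  set c := fun t => (S.Cu - S.Du * gain S Q R (P t))ᵀ *ᵥ y t
  set b : ℝ → Fin r → ℝ := fun t => ∫ s in (0 : ℝ)..t, c s with hb
  have hbeq : ∀ t ∈ Icc 0 T, b t = b 0 + ∫ s in (0 : ℝ)..t, c s := fun t _ => by simp [hb]
  have hbac := absolutelyContinuousOnInterval_of_eq_integral hT hc hbeq
  have hbd := ae_hasDerivAt_of_eq_integral hT hc hbeq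
  have hbc : ContinuousOn b (Icc 0 T) := by simpa [uIcc_of_le hT] using hbac.continuousOn
  obtain ⟨ρ, h0, hρ⟩ := exists_affine_ode_solution hT hM (hM.matrix_mulVec' hbc) 0
  have hρac := absolutelyContinuousOnInterval_of_hasDerivWithinAt hT hρ
    ((hM.matrix_mulVec' fun s hs => (hρ s hs).continuousWithinAt).add (hM.matrix_mulVec' hbc))
  refine ⟨fun t => ρ t + b t, (acOn_Icc_iff hT).2 (hρac.fun_add hbac), by simp [h0, hb], ?_⟩
  filter_upwards [ae_hasDerivAt_of_hasDerivWithinAt hρ, hbd] with t h1 h2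
  rw [mulVec_add]
  exact h1.add h2

/-- In the derivative of `v(T - t)ᵀ r(t)` the closed-loop terms cancel, since both gains are
evaluated at time `t`, and only `u*(T - t)ᵀ y(t)` survives. The boundary term at `t = 0` vanishes
with `r 0`. -/
theorem observerOutput_eq (hT : 0 ≤ T) {ℓ : Fin m → ℝ} {v : ℝ → Fin r → ℝ}
    (hv : IsClosedLoopState S F Q R ℓ T P v) {y : ℝ → Fin p → ℝ} {r' : ℝ → Fin r → ℝ}
    (hr : IsObserverState S Q R T P y r') :
    observerOutput (fun s => optimalControl S Q R T P v (T - s)) y T =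
      ℓ ⬝ᵥ ((F * (S.stateMap F)ᵀ) *ᵥ r' T) := by
  have hvac := ((acOn_Icc_iff hT).1 hv.ac).comp_sub_left hT
  have hrac := (acOn_Icc_iff hT).1 hr.ac
  have hvd : ∀ᵐ t ∂volume.restrict (Icc 0 T), HasDerivAt (fun s => v (T - s))
      (-((S.A - S.B * gain S Q R (P t)) *ᵥ v (T - t))) t := by
    filter_upwards [ae_Icc_comp_sub_left hv.deriv] with t ht
    rw [sub_sub_cancel] at ht
    exact ht.comp_sub_left
  have key := hvac.integral_dotProduct hT hrac hvd hr.deriv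
  simp only [sub_self, hr.init, hv.init, dotProduct_zero, sub_zero] at key
  rw [← mulVec_mulVec, ← transpose_transpose F, ← mulVec_dotProduct_eq, ← mulVec_dotProduct_eq,
    transpose_transpose F, ← key, observerOutput]
  congr 1
  funext t
  simp only [optimalControl, sub_sub_cancel, neg_dotProduct, dotProduct_add, mulVec_dotProduct_eq]
  rw [dotProduct_comm (y t), mulVec_dotProduct_eq]
  ring

end LQ

/-! ### The Hilbert space of disturbances -/

-- A change of variables that removes the weights: for an inverse weight `M`, dual data scaled by
-- `N` and disturbances scaled by `N'` carry Euclidean norms, while `N'ᵀN = 1` preserves the pairing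
-- between them.
open scoped MatrixOrder in
theorem Matrix.PosDef.exists_factor {ι : Type*} [Fintype ι] [DecidableEq ι] {M : Matrix ι ι ℝ}
    (hM : M.PosDef) : ∃ N N' : Matrix ι ι ℝ, Nᵀ * N = M ∧ N'ᵀ * N' = M⁻¹ ∧ N'ᵀ * N = 1 ∧
      N * N'ᵀ = 1 := by
  obtain ⟨N, hN⟩ : ∃ N : Matrix ι ι ℝ, M = Nᵀ * N := by
    obtain ⟨N, hN⟩ := CStarAlgebra.nonneg_iff_eq_star_mul_self.1 hM.posSemidef.nonneg
    exact ⟨N, by rw [hN, star_eq_conjTranspose, conjTranspose_eq_transpose_of_trivial]⟩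
  have hdet : IsUnit N.det := by
    have := (isUnit_iff_isUnit_det _).1 hM.isUnit
    rw [hN, det_mul] at this
    exact isUnit_of_mul_isUnit_right this
  refine ⟨N, (N⁻¹)ᵀ, hN.symm, ?_, ?_, ?_⟩
  · rw [transpose_transpose, hN, mul_inv_rev, transpose_nonsing_inv]
  · rw [transpose_transpose, nonsing_inv_mul _ hdet]
  · rw [transpose_transpose, mul_nonsing_inv _ hdet]

/-- The Hilbert space of pairs of a vector and a square integrable function on `[0, T]`. -/
abbrev SignalSpace (κ ι : Type*) [Fintype κ] [Fintype ι] (T : ℝ) : Type _ :=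
  WithLp 2 (EuclideanSpace ℝ κ × Lp (EuclideanSpace ℝ ι) 2 (volume.restrict (Icc 0 T)))

section Signal

variable {κ ι : Type*} [Fintype κ] [Fintype ι] {T : ℝ}

theorem memLp_toLp_comp {φ : ℝ → ι → ℝ} {μ : Measure ℝ} (hφ : MemLp φ 2 μ) :
    MemLp (fun t => (WithLp.toLp 2 (φ t) : EuclideanSpace ℝ ι)) 2 μ :=
  (EuclideanSpace.equiv ι ℝ).symm.toContinuousLinearMap.comp_memLp' hφ

/-- The element of `SignalSpace` given by a vector and a square integrable function. -/
noncomputable def signal (a : κ → ℝ) {φ : ℝ → ι → ℝ} (hφ : MemLp φ 2 (volume.restrict (Icc 0 T))) :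
    SignalSpace κ ι T :=
  WithLp.toLp 2 (WithLp.toLp 2 a, (memLp_toLp_comp hφ).toLp _)

theorem inner_signal (hT : 0 ≤ T) (a b : κ → ℝ) {φ ψ : ℝ → ι → ℝ}
    (hφ : MemLp φ 2 (volume.restrict (Icc 0 T))) (hψ : MemLp ψ 2 (volume.restrict (Icc 0 T))) :
    inner ℝ (signal a hφ) (signal b hψ) = a ⬝ᵥ b + ∫ t in (0 : ℝ)..T, φ t ⬝ᵥ ψ t := by
  rw [WithLp.prod_inner_apply, L2.inner_def, intervalIntegral.integral_of_le hT,
    ← integral_Icc_eq_integral_Ioc]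
  congr 1
  · simp [signal, EuclideanSpace.inner_eq_star_dotProduct, dotProduct_comm]
  · refine integral_congr_ae ?_
    filter_upwards [(memLp_toLp_comp hφ).coeFn_toLp, (memLp_toLp_comp hψ).coeFn_toLp] with t h1 h2
    simp only [signal, h1, h2, EuclideanSpace.inner_eq_star_dotProduct, star_trivial]
    exact dotProduct_comm _ _

theorem exists_eq_signal (X : SignalSpace κ ι T) : ∃ (a : κ → ℝ) (φ : ℝ → ι → ℝ)
    (hφ : MemLp φ 2 (volume.restrict (Icc 0 T))), X = signal a hφ := by
  refine ⟨WithLp.ofLp X.fst, fun t => WithLp.ofLp (X.snd t),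
    (EuclideanSpace.equiv ι ℝ).toContinuousLinearMap.comp_memLp' (Lp.memLp X.snd), ?_⟩
  refine (WithLp.ofLp_injective 2) (Prod.ext rfl ?_)
  exact (Lp.toLp_coeFn X.snd (Lp.memLp X.snd)).symm

theorem signal_add (a b : κ → ℝ) {φ ψ : ℝ → ι → ℝ}
    (hφ : MemLp φ 2 (volume.restrict (Icc 0 T))) (hψ : MemLp ψ 2 (volume.restrict (Icc 0 T))) :
    signal a hφ + signal b hψ = signal (a + b) (hφ.add hψ) := rfl

theorem smul_signal (c : ℝ) (a : κ → ℝ) {φ : ℝ → ι → ℝ}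
    (hφ : MemLp φ 2 (volume.restrict (Icc 0 T))) :
    c • signal a hφ = signal (c • a) (hφ.const_smul c) := rfl

theorem signal_congr {a b : κ → ℝ} (hab : a = b) {φ ψ : ℝ → ι → ℝ}
    (hφ : MemLp φ 2 (volume.restrict (Icc 0 T))) (hψ : MemLp ψ 2 (volume.restrict (Icc 0 T)))
    (h : ∀ᵐ t ∂volume.restrict (Icc 0 T), φ t = ψ t) : signal a hφ = signal b hψ := by
  subst hab
  rw [signal, signal]
  congr 2
  refine MemLp.toLp_congr _ _ ?_
  filter_upwards [h] with t ht
  rw [ht]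

theorem memLp_mulVec {ν : Type*} [Fintype ν] {φ : ℝ → ι → ℝ} {μ : Measure ℝ} (hφ : MemLp φ 2 μ)
    (M : Matrix ν ι ℝ) : MemLp (fun t => M *ᵥ φ t) 2 μ :=
  M.mulVecLin.toContinuousLinearMap.comp_memLp' hφ

theorem memLp_comp_index {ν : Type*} [Fintype ν] {φ : ℝ → ι → ℝ} {μ : Measure ℝ}
    (hφ : MemLp φ 2 μ) (e : ν → ι) : MemLp (fun t => φ t ∘ e) 2 μ :=
  (ContinuousLinearMap.pi fun i : ν =>
    ContinuousLinearMap.proj (R := ℝ) (φ := fun _ : ι => ℝ) (e i)).comp_memLp' hφ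

theorem integrable_dotProduct {φ ψ : ℝ → ι → ℝ} {μ : Measure ℝ}
    (hφ : MemLp φ 2 μ) (hψ : MemLp ψ 2 μ) : Integrable (fun t => φ t ⬝ᵥ ψ t) μ :=
  integrable_finsetSum _ fun i _ =>
    MemLp.integrable_mul (((ContinuousLinearMap.proj (R := ℝ) (φ := fun _ : ι => ℝ) i).comp_memLp' hφ))
      (((ContinuousLinearMap.proj (R := ℝ) (φ := fun _ : ι => ℝ) i).comp_memLp' hψ))

theorem memLp_sumElim {κ' : Type*} [Fintype κ'] {f : ℝ → κ → ℝ} {g : ℝ → κ' → ℝ} {μ : Measure ℝ}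
    (hf : MemLp f 2 μ) (hg : MemLp g 2 μ) :
    MemLp (fun t => Sum.elim (f t) (g t)) 2 μ := by
  classical
  have h1 := memLp_mulVec hf (fromRows (1 : Matrix κ κ ℝ) (0 : Matrix κ' κ ℝ))
  have h2 := memLp_mulVec hg (fromRows (0 : Matrix κ κ' ℝ) (1 : Matrix κ' κ' ℝ))
  refine (h1.add h2).ae_eq (Filter.Eventually.of_forall fun t => ?_)
  ext (i | i) <;> simp [fromRows_mulVec]

end Signal

/-! ### Solutions of differential-algebraic equations -/

section DAE

variable {m n : ℕ} {F A : Matrix (Fin m) (Fin n) ℝ} {T : ℝ} {x : ℝ → Fin n → ℝ}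
  {f z : ℝ → Fin m → ℝ}

theorem IsDAESolution.memLp_rhs (h : IsDAESolution F A (Icc 0 T) x f z) :
    MemLp (fun t => A *ᵥ x t + f t) 2 (volume.restrict (Icc 0 T)) :=
  (memLp_mulVec (l2Loc_Icc_iff.1 h.x_mem) A).add (l2Loc_Icc_iff.1 h.f_mem)

theorem IsDAESolution.ae_hasDerivAt (hT : 0 ≤ T) (h : IsDAESolution F A (Icc 0 T) x f z) :
    ∀ᵐ t ∂volume.restrict (Icc 0 T), HasDerivAt z (A *ᵥ x t + f t) t :=
  ae_hasDerivAt_of_eq_integral hT (memLp_one_of_two h.memLp_rhs) h.eqn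

theorem IsDAESolution.continuousOn (hT : 0 ≤ T) (h : IsDAESolution F A (Icc 0 T) x f z) :
    ContinuousOn z (Icc 0 T) := by
  simpa [uIcc_of_le hT] using ((acOn_Icc_iff hT).1 h.ac).continuousOn

/-- The continuous representative of `F x` takes values in the range of `F`. -/
theorem IsDAESolution.mul_pinv_mulVec (hT : 0 < T) (h : IsDAESolution F A (Icc 0 T) x f z) :
    ∀ t ∈ Icc 0 T, F *ᵥ (pinv F *ᵥ z t) = z t := by
  have hc := h.continuousOn hT.le
  refine Measure.eqOn_Icc_of_ae_eq volume hT.ne ?_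
    (continuousOn_const.matrix_mulVec' (continuousOn_const.matrix_mulVec' hc)) hc
  filter_upwards [h.ae_eq] with t ht
  rw [ht, mulVec_mulVec, mulVec_mulVec, (pinv_spec F).mul_mul]

/-- The representative stays in the range of `F`, which is fixed by `F F⁺`, so its derivative stays
there too. -/
theorem IsDAESolution.ae_mul_pinv_mulVec_rhs (hT : 0 < T)
    (h : IsDAESolution F A (Icc 0 T) x f z) : ∀ᵐ t ∂volume.restrict (Icc 0 T),
      F *ᵥ (pinv F *ᵥ (A *ᵥ x t + f t)) = A *ᵥ x t + f t := by
  have hd := h.ae_hasDerivAt hT.le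
  rw [← restrict_Ioo_eq_restrict_Icc] at hd ⊢
  filter_upwards [hd, ae_restrict_mem measurableSet_Ioo] with t ht hmem
  refine ((ht.matrix_mulVec (pinv F)).matrix_mulVec F).unique (ht.congr_of_eventuallyEq ?_)
  filter_upwards [Icc_mem_nhds hmem.1 hmem.2] with s hs using h.mul_pinv_mulVec hT s hs

end DAE

/-! ### Duality pairing, error formula and orthogonality to zero-output solutions -/

section Duality

variable {m n p : ℕ} {F A : Matrix (Fin m) (Fin n) ℝ} {H : Matrix (Fin p) (Fin n) ℝ} {T : ℝ}
  {x : ℝ → Fin n → ℝ} {f z : ℝ → Fin m → ℝ} {y η : ℝ → Fin p → ℝ}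
  {q : ℝ → Fin m → ℝ} {u : ℝ → Fin p → ℝ} {w : ℝ → Fin n → ℝ}

/-- Duality between the solutions of `d(Fx)/dt = A x + f` and the time-reversed solutions of the
dual equation. -/
theorem IsDAESolution.duality (hT : 0 < T) (h : IsDAESolution F A (Icc 0 T) x f z)
    (hd : IsDualSolution F A H (Icc 0 T) q u w) {a b : Fin m → ℝ} (ha : Fᵀ *ᵥ a = w T)
    (hb : Fᵀ *ᵥ b = w 0) :
    b ⬝ᵥ z T = a ⬝ᵥ z 0 + ∫ t in (0 : ℝ)..T, (q (T - t) ⬝ᵥ f t + u (T - t) ⬝ᵥ (H *ᵥ x t)) := by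
  have hw := hd.dae.ae_hasDerivAt hT.le
  have hwac := ((acOn_Icc_iff hT.le).1 hd.dae.ac).comp_sub_left hT.le
  have hzac := ((acOn_Icc_iff hT.le).1 h.ac).mulVec (pinv F)
  -- The natural pairing is `qᵀFx`, but `q` and `x` are merely square integrable. Since `w = Fᵀq`
  -- and `z = Fx` almost everywhere, `wᵀF⁺z` equals it a.e., and this product is absolutely
  -- continuous.
  have key := (hwac.dotProduct hzac).integral_eq_sub_of_ae hT.le
    (f' := fun t => q (T - t) ⬝ᵥ f t + u (T - t) ⬝ᵥ (H *ᵥ x t)) ?_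
  · have e : ∀ c t, t ∈ Icc 0 T → (Fᵀ *ᵥ c) ⬝ᵥ (pinv F *ᵥ z t) = c ⬝ᵥ z t := fun c t ht => by
      rw [mulVec_dotProduct_eq, transpose_transpose, h.mul_pinv_mulVec hT t ht]
    rw [key, sub_self, sub_zero, ← ha, ← hb, e _ _ ⟨hT.le, le_rfl⟩, e _ _ ⟨le_rfl, hT.le⟩]
    ring
  · filter_upwards [ae_Icc_comp_sub_left hw, h.ae_hasDerivAt hT.le,
      ae_Icc_comp_sub_left hd.dae.ae_eq, h.ae_eq,
      ae_Icc_comp_sub_left (hd.dae.ae_mul_pinv_mulVec_rhs hT), h.ae_mul_pinv_mulVec_rhs hT]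
      with t h1 h2 h3 h4 h5 h6
    refine (h1.comp_sub_left.dotProduct (h2.matrix_mulVec (pinv F))).congr_deriv ?_
    set w' := Aᵀ *ᵥ q (T - t) + -(Hᵀ *ᵥ u (T - t))
    rw [pinv_transpose] at h5
    -- The derivative `w'` lies in the range of `Fᵀ`, so replacing `x` by `F⁺Fx` does not change its
    -- pairing with `w'`.
    have e1 : w' ⬝ᵥ (pinv F *ᵥ z t) = w' ⬝ᵥ x t := by
      conv_rhs => rw [← h5]
      rw [h4, mulVec_dotProduct_eq, mulVec_dotProduct_eq, transpose_transpose, transpose_transpose]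
    have e2 : w (T - t) ⬝ᵥ (pinv F *ᵥ (A *ᵥ x t + f t)) = q (T - t) ⬝ᵥ (A *ᵥ x t + f t) := by
      rw [h3, mulVec_dotProduct_eq, transpose_transpose, h6]
    rw [neg_dotProduct, e1, e2, add_dotProduct, neg_dotProduct, mulVec_dotProduct_eq,
      mulVec_dotProduct_eq, transpose_transpose, transpose_transpose, dotProduct_add]
    ring

/-- The estimation error of the observer `t ↦ u (T - t)` in terms of the disturbances. -/
theorem IsSolution.error_eq (hT : 0 < T) (h : IsSolution F A H (Icc 0 T) x f y η z)
    (hd : IsDualSolution F A H (Icc 0 T) q u w) {a b : Fin m → ℝ} (ha : Fᵀ *ᵥ a = w T)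
    (hb : Fᵀ *ᵥ b = w 0) :
    b ⬝ᵥ z T - observerOutput (fun s => u (T - s)) y T = a ⬝ᵥ z 0 +
      ∫ t in (0 : ℝ)..T, Sum.elim (q (T - t)) (-u (T - t)) ⬝ᵥ Sum.elim (f t) (η t) := by
  have hq := memLp_comp_sub_left (l2Loc_Icc_iff.1 hd.dae.x_mem)
  have hu := memLp_comp_sub_left (l2Loc_Icc_iff.1 hd.u_mem)
  have hx := memLp_mulVec (l2Loc_Icc_iff.1 h.dae.x_mem) H
  have hf := l2Loc_Icc_iff.1 h.dae.f_mem
  have hy := l2Loc_Icc_iff.1 h.y_mem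
  have hTT : T ∈ Icc 0 T := ⟨hT.le, le_rfl⟩
  have i1 : IntervalIntegrable (fun t => q (T - t) ⬝ᵥ f t + u (T - t) ⬝ᵥ (H *ᵥ x t)) volume 0 T :=
    IntegrableOn.intervalIntegrable_Icc ((integrable_dotProduct hq hf).add (integrable_dotProduct hu hx)) hTT
  have i2 := IntegrableOn.intervalIntegrable_Icc (integrable_dotProduct hy hu) hTT
  rw [h.dae.duality hT hd ha hb, observerOutput, add_sub_assoc]
  congr 1
  rw [← intervalIntegral.integral_sub i1 i2]
  refine intervalIntegral_congr_ae_Icc hTT ?_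
  filter_upwards [h.output] with t ht
  simp only [ht, sumElim_dotProduct_sumElim, add_dotProduct, neg_dotProduct,
    dotProduct_comm (H *ᵥ x t), dotProduct_comm (η t)]
  ring

theorem IsDAESolution.add {x' : ℝ → Fin n → ℝ} {f' z' : ℝ → Fin m → ℝ} (hT : 0 ≤ T)
    (h : IsDAESolution F A (Icc 0 T) x f z) (h' : IsDAESolution F A (Icc 0 T) x' f' z') :
    IsDAESolution F A (Icc 0 T) (x + x') (f + f') (z + z') where
  x_mem := l2Loc_Icc_iff.2 ((l2Loc_Icc_iff.1 h.x_mem).add (l2Loc_Icc_iff.1 h'.x_mem))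
  f_mem := l2Loc_Icc_iff.2 ((l2Loc_Icc_iff.1 h.f_mem).add (l2Loc_Icc_iff.1 h'.f_mem))
  ac := (acOn_Icc_iff hT).2 (((acOn_Icc_iff hT).1 h.ac).add ((acOn_Icc_iff hT).1 h'.ac))
  ae_eq := by
    filter_upwards [h.ae_eq, h'.ae_eq] with t h1 h2
    simp only [Pi.add_apply, h1, h2, mulVec_add]
  eqn t ht := by
    have i1 := (memLp_one_of_two h.memLp_rhs).intervalIntegrable_Icc ht
    have i2 := (memLp_one_of_two h'.memLp_rhs).intervalIntegrable_Icc ht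
    have e : ∀ s, A *ᵥ (x + x') s + (f + f') s = (A *ᵥ x s + f s) + (A *ᵥ x' s + f' s) := fun s => by
      simp only [Pi.add_apply, mulVec_add]; abel
    simp only [e]
    rw [intervalIntegral.integral_add i1 i2, Pi.add_apply, Pi.add_apply, h.eqn t ht, h'.eqn t ht]
    abel

theorem IsDAESolution.smul (c : ℝ) (hT : 0 ≤ T)
    (h : IsDAESolution F A (Icc 0 T) x f z) :
    IsDAESolution F A (Icc 0 T) (c • x) (c • f) (c • z) where
  x_mem := l2Loc_Icc_iff.2 ((l2Loc_Icc_iff.1 h.x_mem).const_smul c)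
  f_mem := l2Loc_Icc_iff.2 ((l2Loc_Icc_iff.1 h.f_mem).const_smul c)
  ac := (acOn_Icc_iff hT).2 (((acOn_Icc_iff hT).1 h.ac).const_smul c)
  ae_eq := by
    filter_upwards [h.ae_eq] with t h1
    simp only [Pi.smul_apply, h1, mulVec_smul]
  eqn t ht := by
    have e : ∀ s, A *ᵥ (c • x) s + (c • f) s = c • (A *ᵥ x s + f s) := fun s => by
      simp only [Pi.smul_apply, mulVec_smul, smul_add]
    simp only [e]
    rw [intervalIntegral.integral_smul, Pi.smul_apply, Pi.smul_apply, h.eqn t ht, smul_add]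

theorem IsSolution.add {x' : ℝ → Fin n → ℝ} {f' z' : ℝ → Fin m → ℝ} {y' η' : ℝ → Fin p → ℝ}
    (hT : 0 ≤ T) (h : IsSolution F A H (Icc 0 T) x f y η z)
    (h' : IsSolution F A H (Icc 0 T) x' f' y' η' z') :
    IsSolution F A H (Icc 0 T) (x + x') (f + f') (y + y') (η + η') (z + z') where
  dae := h.dae.add hT h'.dae
  y_mem := l2Loc_Icc_iff.2 ((l2Loc_Icc_iff.1 h.y_mem).add (l2Loc_Icc_iff.1 h'.y_mem))
  η_mem := l2Loc_Icc_iff.2 ((l2Loc_Icc_iff.1 h.η_mem).add (l2Loc_Icc_iff.1 h'.η_mem))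
  output := by
    filter_upwards [h.output, h'.output] with t h1 h2
    simp only [Pi.add_apply, h1, h2, mulVec_add]
    abel

theorem IsSolution.smul (c : ℝ) (hT : 0 ≤ T) (h : IsSolution F A H (Icc 0 T) x f y η z) :
    IsSolution F A H (Icc 0 T) (c • x) (c • f) (c • y) (c • η) (c • z) where
  dae := h.dae.smul c hT
  y_mem := l2Loc_Icc_iff.2 ((l2Loc_Icc_iff.1 h.y_mem).const_smul c)
  η_mem := l2Loc_Icc_iff.2 ((l2Loc_Icc_iff.1 h.η_mem).const_smul c)
  output := by
    filter_upwards [h.output] with t h1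
    simp only [Pi.smul_apply, h1, mulVec_smul, smul_add]

/-- Solutions with zero output and absolutely continuous state. -/
theorem isSolution_of_primitive (F A : Matrix (Fin m) (Fin n) ℝ) (H : Matrix (Fin p) (Fin n) ℝ)
    (hT : 0 ≤ T) {h : ℝ → Fin n → ℝ} (hh : MemLp h 2 (volume.restrict (Icc 0 T)))
    (hx : ∀ t ∈ Icc 0 T, x t = x 0 + ∫ s in (0 : ℝ)..t, h s) :
    IsSolution F A H (Icc 0 T) x (fun t => F *ᵥ h t - A *ᵥ x t) 0 (fun t => -(H *ᵥ x t))
      (fun t => F *ᵥ x t) := by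
  have hxac := absolutelyContinuousOnInterval_of_eq_integral hT (memLp_one_of_two hh) hx
  have hxc : ContinuousOn x (Icc 0 T) := by simpa [uIcc_of_le hT] using hxac.continuousOn
  have hxm := hxc.memLp_Icc 2
  have hxd := ae_hasDerivAt_of_eq_integral hT (memLp_one_of_two hh) hx
  refine ⟨⟨l2Loc_Icc_iff.2 hxm,
    l2Loc_Icc_iff.2 ((memLp_mulVec hh F).sub (memLp_mulVec hxm A)),
    (acOn_Icc_iff hT).2 (hxac.mulVec F), Filter.Eventually.of_forall fun t => rfl, ?_⟩,
    l2Loc_Icc_iff.2 MemLp.zero, l2Loc_Icc_iff.2 (memLp_mulVec hxm H).neg, ?_⟩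
  · intro t ht
    simp only [add_sub_cancel]
    exact (hxac.mulVec F).eq_add_integral
      (by filter_upwards [hxd] with s hs using hs.matrix_mulVec F) ht
  · exact Filter.Eventually.of_forall fun t => by simp

theorem dotProduct_self_nonneg {ι : Type*} [Fintype ι] (v : ι → ℝ) : 0 ≤ v ⬝ᵥ v :=
  Finset.sum_nonneg fun _ _ => mul_self_nonneg _

theorem intervalIntegral_dotProduct_self_eq_zero {ι : Type*} [Fintype ι] (hT : 0 ≤ T)
    {h : ℝ → ι → ℝ} (hh : MemLp h 2 (volume.restrict (Icc 0 T)))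
    (h0 : ∫ t in (0 : ℝ)..T, h t ⬝ᵥ h t = 0) : ∀ᵐ t ∂volume.restrict (Icc 0 T), h t = 0 := by
  rw [intervalIntegral.integral_of_le hT, ← integral_Icc_eq_integral_Ioc,
    integral_eq_zero_iff_of_nonneg (fun t => dotProduct_self_nonneg _)
      (integrable_dotProduct hh hh)] at h0
  filter_upwards [h0] with t ht
  exact dotProduct_self_eq_zero.1 ht

/-- A functional vanishing on all solutions with zero output is given by a solution of the dual
equation with zero initial value. -/
theorem exists_isDualSolution_of_orthogonal (hT : 0 ≤ T) {a : Fin m → ℝ} {φ : ℝ → Fin m → ℝ}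
    {ψ : ℝ → Fin p → ℝ} (hφ : MemLp φ 2 (volume.restrict (Icc 0 T)))
    (hψ : MemLp ψ 2 (volume.restrict (Icc 0 T)))
    (horth : ∀ x f η z, IsSolution F A H (Icc 0 T) x f 0 η z →
      a ⬝ᵥ z 0 + ∫ t in (0 : ℝ)..T, (φ t ⬝ᵥ f t + ψ t ⬝ᵥ η t) = 0) :
    ∃ w, IsDualSolution F A H (Icc 0 T) (fun s => φ (T - s)) (fun s => -ψ (T - s)) w ∧
      w 0 = 0 ∧ w T = Fᵀ *ᵥ a := by
  have hTT : T ∈ Icc 0 T := ⟨hT, le_rfl⟩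
  set β : ℝ → Fin n → ℝ := fun t => -(Aᵀ *ᵥ φ t + Hᵀ *ᵥ ψ t) with hβ
  have hβm : MemLp β 2 (volume.restrict (Icc 0 T)) :=
    ((memLp_mulVec hφ Aᵀ).add (memLp_mulVec hψ Hᵀ)).neg
  set b : ℝ → Fin n → ℝ := fun t => ∫ s in (0 : ℝ)..t, β s with hb
  have hb0 : b 0 = 0 := by simp [hb]
  have hbeq : ∀ t ∈ Icc 0 T, b t = b 0 + ∫ s in (0 : ℝ)..t, β s := fun t _ => by
    rw [hb0, zero_add]
  have hbac := absolutelyContinuousOnInterval_of_eq_integral hT (memLp_one_of_two hβm) hbeq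
  have hbd := ae_hasDerivAt_of_eq_integral hT (memLp_one_of_two hβm) hbeq
  have hbc : ContinuousOn b (Icc 0 T) := by simpa [uIcc_of_le hT] using hbac.continuousOn
  have hbm := hbc.memLp_Icc 2
  have hFφ := memLp_mulVec hφ Fᵀ
  -- Du Bois-Reymond argument: `h` is the defect in the integrated dual equation and `c` the defect
  -- in the terminal value. Testing the functional on the trajectory with `x' = h`, `x 0 = c` and
  -- integrating by parts yields `cᵀc + ∫ hᵀh = 0`, so both defects vanish.
  set h : ℝ → Fin n → ℝ := fun t => Fᵀ *ᵥ φ t + b T - b t with hh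
  have hhm : MemLp h 2 (volume.restrict (Icc 0 T)) :=
    (hFφ.add ((continuousOn_const (c := b T)).memLp_Icc 2)).sub hbm
  set c := Fᵀ *ᵥ a + b T with hc
  set x : ℝ → Fin n → ℝ := fun t => c + ∫ s in (0 : ℝ)..t, h s with hxdef
  have hx0 : x 0 = c := by simp [hxdef]
  have hx : ∀ t ∈ Icc 0 T, x t = x 0 + ∫ s in (0 : ℝ)..t, h s := fun t _ => by rw [hx0]
  have hxac := absolutelyContinuousOnInterval_of_eq_integral hT (memLp_one_of_two hhm) hx
  have hxd := ae_hasDerivAt_of_eq_integral hT (memLp_one_of_two hhm) hx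
  have hxc : ContinuousOn x (Icc 0 T) := by simpa [uIcc_of_le hT] using hxac.continuousOn
  have hxm := hxc.memLp_Icc 2
  have h1 := horth _ _ _ _ (isSolution_of_primitive F A H hT hhm hx)
  have h2 := hbac.integral_dotProduct hT hxac hbd hxd
  have hbT : b T ⬝ᵥ x T = b T ⬝ᵥ c + ∫ t in (0 : ℝ)..T, b T ⬝ᵥ h t := by
    have := ((absolutelyContinuousOnInterval_const (b T) 0 T).dotProduct hxac).integral_eq_sub_of_ae
      hT (f' := fun t => b T ⬝ᵥ h t) (by
        filter_upwards [hxd] with t ht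
        simpa using (hasDerivAt_const t (b T)).dotProduct ht)
    rw [this, hx0]; ring
  have i1 : IntervalIntegrable (fun t => φ t ⬝ᵥ (F *ᵥ h t - A *ᵥ x t) + ψ t ⬝ᵥ -(H *ᵥ x t))
      volume 0 T := IntegrableOn.intervalIntegrable_Icc
    ((integrable_dotProduct hφ ((memLp_mulVec hhm F).sub (memLp_mulVec hxm A))).add
      (integrable_dotProduct hψ (memLp_mulVec hxm H).neg)) hTT
  have i2 : IntervalIntegrable (fun t => β t ⬝ᵥ x t + b t ⬝ᵥ h t) volume 0 T :=
    IntegrableOn.intervalIntegrable_Icc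
      ((integrable_dotProduct hβm hxm).add (integrable_dotProduct hbm hhm)) hTT
  have i3 : IntervalIntegrable (fun t => b T ⬝ᵥ h t) volume 0 T :=
    IntegrableOn.intervalIntegrable_Icc
      (integrable_dotProduct ((continuousOn_const (c := b T)).memLp_Icc 2) hhm) hTT
  have hsum : ∫ t in (0 : ℝ)..T, h t ⬝ᵥ h t =
      (∫ t in (0 : ℝ)..T, (φ t ⬝ᵥ (F *ᵥ h t - A *ᵥ x t) + ψ t ⬝ᵥ -(H *ᵥ x t)))
      - (∫ t in (0 : ℝ)..T, (β t ⬝ᵥ x t + b t ⬝ᵥ h t)) + ∫ t in (0 : ℝ)..T, b T ⬝ᵥ h t := by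
    rw [← intervalIntegral.integral_sub i1 i2, ← intervalIntegral.integral_add (i1.sub i2) i3]
    refine intervalIntegral.integral_congr fun t _ => ?_
    have e : h t ⬝ᵥ h t = φ t ⬝ᵥ (F *ᵥ h t) + b T ⬝ᵥ h t - b t ⬝ᵥ h t := by
      conv_lhs => rw [hh]
      simp only [sub_dotProduct, add_dotProduct, mulVec_dotProduct_eq, transpose_transpose]
      rw [hh]
    simp only [e, hβ, dotProduct_sub, dotProduct_neg, neg_dotProduct, add_dotProduct,
      mulVec_dotProduct_eq, transpose_transpose]
    ring
  have hcc : c ⬝ᵥ c + ∫ t in (0 : ℝ)..T, h t ⬝ᵥ h t = 0 := by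
    rw [hb0, zero_dotProduct, sub_zero, hbT] at h2
    rw [hsum, h2]
    simp only [hx0] at h1
    have : c ⬝ᵥ c = a ⬝ᵥ (F *ᵥ c) + b T ⬝ᵥ c := by
      nth_rw 1 [hc]
      rw [add_dotProduct, mulVec_dotProduct_eq, transpose_transpose]
    rw [this]
    linarith
  have hpos : 0 ≤ ∫ t in (0 : ℝ)..T, h t ⬝ᵥ h t :=
    intervalIntegral.integral_nonneg hT fun t _ => dotProduct_self_nonneg _
  have hc0 : c = 0 := dotProduct_self_eq_zero.1
    (le_antisymm (by linarith) (dotProduct_self_nonneg c))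
  have hh0 := intervalIntegral_dotProduct_self_eq_zero hT hhm
    (by linarith [dotProduct_self_nonneg c])
  have hwac : AbsolutelyContinuousOnInterval (fun s => b (T - s) - b T) 0 T :=
    (hbac.comp_sub_left hT).fun_sub (absolutelyContinuousOnInterval_const (b T) 0 T)
  refine ⟨fun s => b (T - s) - b T, ⟨?_, ?_, ?_, ?_, ?_, ?_⟩, by simp, ?_⟩
  · exact l2Loc_Icc_iff.2 (memLp_comp_sub_left hψ).neg
  · exact l2Loc_Icc_iff.2 (memLp_comp_sub_left hφ)
  · exact l2Loc_Icc_iff.2 (memLp_mulVec (memLp_comp_sub_left hψ).neg Hᵀ).neg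
  · exact (acOn_Icc_iff hT).2 hwac
  · filter_upwards [ae_Icc_comp_sub_left hh0] with s hs
    exact sub_eq_of_eq_add (sub_eq_zero.1 hs).symm
  · intro t ht
    refine hwac.eq_add_integral (f' := fun s => Aᵀ *ᵥ φ (T - s) + -(Hᵀ *ᵥ -ψ (T - s))) ?_ ht
    filter_upwards [ae_Icc_comp_sub_left hbd] with s hs
    refine (hs.comp_sub_left.sub_const (b T)).congr_deriv ?_
    simp [hβ, mulVec_neg]
  · simp only [sub_self, hb0, zero_sub]
    rw [neg_eq_iff_add_eq_zero, add_comm]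
    exact hc0

end Duality

/-! ### Minimax observers -/

theorem weight_inv {m p : ℕ} {Q : Matrix (Fin m) (Fin m) ℝ} {R : Matrix (Fin p) (Fin p) ℝ}
    (hQ : Q.PosDef) (hR : R.PosDef) : (weight Q R)⁻¹ = fromBlocks Q 0 0 R := by
  refine inv_eq_right_inv ?_
  rw [weight, fromBlocks_multiply]
  simp [nonsing_inv_mul _ ((isUnit_iff_isUnit_det _).1 hQ.isUnit),
    nonsing_inv_mul _ ((isUnit_iff_isUnit_det _).1 hR.isUnit)]

/-- A continuous linear functional on a Hilbert space which is bounded by `√c` on the unit ball of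
a subspace has norm at most `√c` if its representing vector lies in the closure of the subspace. -/
theorem inner_self_le_of_mem_closure {E : Type*} [NormedAddCommGroup E] [InnerProductSpace ℝ E]
    (V : Submodule ℝ E) {c : ℝ} {φ : E} (hφ : φ ∈ V.topologicalClosure)
    (h : ∀ X ∈ V, inner ℝ X X ≤ 1 → inner ℝ φ X ^ 2 ≤ c) : inner ℝ φ φ ≤ c := by
  have hc : 0 ≤ c := by simpa using h 0 V.zero_mem (by simp)
  -- In homogeneous form the bound is a closed condition; it passes to the closure and can be
  -- evaluated at `φ` itself.
  have hV : ∀ X ∈ V, inner ℝ φ X ^ 2 ≤ c * inner ℝ X X := by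
    intro X hX
    by_cases hX0 : X = 0
    · simp [hX0]
    · have hn : 0 < ‖X‖ := norm_pos_iff.2 hX0
      have := h (‖X‖⁻¹ • X) (V.smul_mem _ hX) (by
        rw [real_inner_self_eq_norm_sq, norm_smul, norm_inv, norm_norm, inv_mul_cancel₀ hn.ne']
        norm_num)
      rw [inner_smul_right, mul_pow, inv_pow, inv_mul_le_iff₀ (by positivity)] at this
      rw [real_inner_self_eq_norm_sq]
      linarith
  have hcl : IsClosed {X : E | inner ℝ φ X ^ 2 ≤ c * inner ℝ X X} :=
    isClosed_le (by fun_prop) (by fun_prop)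
  have hmem : φ ∈ {X : E | inner ℝ φ X ^ 2 ≤ c * inner ℝ X X} :=
    closure_minimal (s := (V : Set E)) hV hcl hφ
  rcases (real_inner_self_nonneg (x := φ)).eq_or_lt with h0 | h0
  · rw [← h0]; exact hc
  · have h1 : inner ℝ φ φ ^ 2 ≤ c * inner ℝ φ φ := hmem
    nlinarith

section Minimax

variable {m n p : ℕ} {F A : Matrix (Fin m) (Fin n) ℝ} {H : Matrix (Fin p) (Fin n) ℝ} {T : ℝ}
  {Q₀ Q : Matrix (Fin m) (Fin m) ℝ} {R : Matrix (Fin p) (Fin p) ℝ}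

/-- The disturbances `(z(0), f, η)`, transformed by `N₀` and `N`, of the solutions with zero
output. -/
def zeroOutputSignals (F A : Matrix (Fin m) (Fin n) ℝ) (H : Matrix (Fin p) (Fin n) ℝ)
    (N₀ : Matrix (Fin m) (Fin m) ℝ) (N : Matrix (Fin m ⊕ Fin p) (Fin m ⊕ Fin p) ℝ) (hT : 0 ≤ T) :
    Submodule ℝ (SignalSpace (Fin m) (Fin m ⊕ Fin p) T) where
  carrier := {X | ∃ x f η z, ∃ h : IsSolution F A H (Icc 0 T) x f 0 η z,
    X = signal (N₀ *ᵥ z 0) (memLp_mulVec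
      (memLp_sumElim (l2Loc_Icc_iff.1 h.dae.f_mem) (l2Loc_Icc_iff.1 h.η_mem)) N)}
  add_mem' := by
    rintro _ _ ⟨x, f, η, z, h, rfl⟩ ⟨x', f', η', z', h', rfl⟩
    have hs := h.add hT h'
    rw [add_zero] at hs
    refine ⟨_, _, _, _, hs, ?_⟩
    rw [signal_add]
    refine signal_congr ?_ _ _ (Filter.Eventually.of_forall fun t => ?_)
    · rw [Pi.add_apply, mulVec_add]
    · rw [Pi.add_apply, ← mulVec_add]
      congr 1
      ext (i | i) <;> rfl
  zero_mem' := by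
    have hs : IsSolution F A H (Icc 0 T) 0 0 0 0 0 := by
      refine ⟨⟨?_, ?_, ?_, ?_, ?_⟩, ?_, ?_, ?_⟩
      any_goals exact l2Loc_Icc_iff.2 MemLp.zero
      · exact (acOn_Icc_iff hT).2 (absolutelyContinuousOnInterval_const 0 0 T)
      · exact Filter.Eventually.of_forall fun t => by simp
      · intro t _; simp
      · exact Filter.Eventually.of_forall fun t => by simp
    refine ⟨_, _, _, _, hs, ?_⟩
    have h0 : (0 : SignalSpace (Fin m) (Fin m ⊕ Fin p) T) =
        signal (0 : Fin m → ℝ) (MemLp.zero (ε := Fin m ⊕ Fin p → ℝ)) := rfl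
    rw [h0]
    refine signal_congr (by simp) _ _ (Filter.Eventually.of_forall fun t => ?_)
    have : Sum.elim ((0 : ℝ → Fin m → ℝ) t) ((0 : ℝ → Fin p → ℝ) t) = 0 := by
      ext (i | i) <;> rfl
    rw [this, mulVec_zero]
    rfl
  smul_mem' := by
    rintro c _ ⟨x, f, η, z, h, rfl⟩
    have hs := h.smul c hT
    rw [smul_zero] at hs
    refine ⟨_, _, _, _, hs, ?_⟩
    rw [smul_signal]
    refine signal_congr ?_ _ _ (Filter.Eventually.of_forall fun t => ?_)
    · rw [Pi.smul_apply, mulVec_smul]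
    · rw [Pi.smul_apply, ← mulVec_smul]
      congr 1
      ext (i | i) <;> rfl

/-- The integrand is nonnegative, so among the admissibility constraints for all `t` the one at the
final time implies the others. -/
theorem rho_le_rho (hQ : Q.PosDef) (hR : R.PosDef) {z₀ : Fin m → ℝ} {f : ℝ → Fin m → ℝ}
    {η : ℝ → Fin p → ℝ} (hf : MemLp f 2 (volume.restrict (Icc 0 T)))
    (hη : MemLp η 2 (volume.restrict (Icc 0 T))) {t : ℝ} (ht : t ∈ Icc 0 T) :
    rho z₀ f η t Q₀ Q R ≤ rho z₀ f η T Q₀ Q R := by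
  have hT : 0 ≤ T := ht.1.trans ht.2
  rw [rho, rho]
  gcongr
  refine intervalIntegral.integral_mono_interval le_rfl ht.1 ht.2
    (Filter.Eventually.of_forall fun s => add_nonneg (hQ.dotProduct_nonneg _)
      (hR.dotProduct_nonneg _)) ?_
  exact IntegrableOn.intervalIntegrable_Icc ((integrable_dotProduct hf (memLp_mulVec hf Q)).add
    (integrable_dotProduct hη (memLp_mulVec hη R))) ⟨hT, le_rfl⟩

theorem isAdmissible_of_rho_le (hQ : Q.PosDef) (hR : R.PosDef) {x : ℝ → Fin n → ℝ}
    {f z : ℝ → Fin m → ℝ} {y η : ℝ → Fin p → ℝ} (h : IsSolution F A H (Icc 0 T) x f y η z)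
    (hb : rho (z 0) f η T Q₀ Q R ≤ 1) : IsAdmissible F A H Q₀ Q R (Icc 0 T) x f y η z :=
  ⟨h, fun _ ht => (rho_le_rho hQ hR (l2Loc_Icc_iff.1 h.dae.f_mem)
    (l2Loc_Icc_iff.1 h.η_mem) ht).trans hb⟩

/-- A solution of the dual equation that is a critical point of the dual cost determines a minimax
observer, and the worst-case error is the dual cost. -/
theorem worstCaseError_of_dual_optimal (hT : 0 < T) (hQ₀ : Q₀.PosDef) (hQ : Q.PosDef)
    (hR : R.PosDef) {ℓ a : Fin m → ℝ} {q : ℝ → Fin m → ℝ} {u : ℝ → Fin p → ℝ} {w : ℝ → Fin n → ℝ}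
    (hd : IsDualSolution F A H (Icc 0 T) q u w) (hw : w 0 = Fᵀ *ᵥ ℓ) (ha : Fᵀ *ᵥ a = w T) {J : ℝ}
    (hJ : a ⬝ᵥ (Q₀⁻¹ *ᵥ a) + ∫ t in (0 : ℝ)..T,
      Sum.elim (q t) (u t) ⬝ᵥ (weight Q R *ᵥ Sum.elim (q t) (u t)) = J)
    (hopt : ∀ a' q' u' w', IsDualSolution F A H (Icc 0 T) q' u' w' → w' 0 = 0 → Fᵀ *ᵥ a' = w' T →
      a' ⬝ᵥ (Q₀⁻¹ *ᵥ a) + ∫ t in (0 : ℝ)..T,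
        Sum.elim (q' t) (u' t) ⬝ᵥ (weight Q R *ᵥ Sum.elim (q t) (u t)) = 0) :
    worstCaseError F A H Q₀ Q R ℓ T (fun s => u (T - s)) = (J : EReal) ∧
    ∀ U : ℝ → Fin p → ℝ, (J : EReal) ≤ worstCaseError F A H Q₀ Q R ℓ T U := by
  obtain ⟨N₀, N₀', h1₀, h2₀, h3₀, h4₀⟩ := hQ₀.inv.exists_factor
  obtain ⟨N, N', h1, h2, h3, h4⟩ := (weight_posDef hQ hR).exists_factor
  rw [nonsing_inv_nonsing_inv _ ((isUnit_iff_isUnit_det _).1 hQ₀.isUnit)] at h2₀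
  rw [weight_inv hQ hR] at h2
  -- The representing vector of the error functional: reversed in time, and with `-u` because `η`
  -- reaches the error through the subtracted observer output.
  have hφ := memLp_sumElim (memLp_comp_sub_left (l2Loc_Icc_iff.1 hd.dae.x_mem))
    (memLp_comp_sub_left (l2Loc_Icc_iff.1 hd.u_mem)).neg
  set φ : SignalSpace (Fin m) (Fin m ⊕ Fin p) T := signal (N₀ *ᵥ a) (memLp_mulVec hφ N) with hφdef
  have hpd : ∀ {κ : Type} [Fintype κ] [DecidableEq κ] {M M' : Matrix κ κ ℝ}, M'ᵀ * M = 1 →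
      ∀ b c : κ → ℝ, (M *ᵥ b) ⬝ᵥ (M' *ᵥ c) = b ⬝ᵥ c := by
    intro κ _ _ M M' h b c
    rw [dotProduct_comm, mulVec_dotProduct_eq, mulVec_mulVec, h, one_mulVec, dotProduct_comm]
  have hmm : ∀ {κ : Type} [Fintype κ] {M L : Matrix κ κ ℝ}, Mᵀ * M = L →
      ∀ b c : κ → ℝ, (M *ᵥ b) ⬝ᵥ (M *ᵥ c) = b ⬝ᵥ (L *ᵥ c) := by
    intro κ _ M L h b c
    rw [mulVec_dotProduct_eq, mulVec_mulVec, h]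
  have herr : ∀ {x f y η z} (h : IsSolution F A H (Icc 0 T) x f y η z),
      ℓ ⬝ᵥ z T - observerOutput (fun s => u (T - s)) y T =
        inner ℝ φ (signal (N₀' *ᵥ z 0) (memLp_mulVec
          (memLp_sumElim (l2Loc_Icc_iff.1 h.dae.f_mem) (l2Loc_Icc_iff.1 h.η_mem)) N')) := by
    intro x f y η z h
    rw [h.error_eq hT hd ha hw.symm, hφdef, inner_signal hT.le, hpd h3₀]
    simp only [hpd h3]
    rfl
  have hrho : ∀ {x f y η z} (h : IsSolution F A H (Icc 0 T) x f y η z)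
      (X : SignalSpace (Fin m) (Fin m ⊕ Fin p) T), X = (signal (N₀' *ᵥ z 0) (memLp_mulVec
          (memLp_sumElim (l2Loc_Icc_iff.1 h.dae.f_mem) (l2Loc_Icc_iff.1 h.η_mem)) N')) →
      inner ℝ X X = rho (z 0) f η T Q₀ Q R := by
    rintro x f y η z h X rfl
    rw [inner_signal hT.le, rho, hmm h2₀]
    simp only [hmm h2, fromBlocks_mulVec, Sum.elim_comp_inl, Sum.elim_comp_inr, zero_mulVec,
      add_zero, zero_add, sumElim_dotProduct_sumElim]
  have hdd : ∀ a' q' u' w', IsDualSolution F A H (Icc 0 T) q' u' w' →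
      ∀ (X : SignalSpace (Fin m) (Fin m ⊕ Fin p) T) {φ' : ℝ → Fin m ⊕ Fin p → ℝ}
        (hφ' : MemLp (fun t => N *ᵥ φ' t) 2 (volume.restrict (Icc 0 T))),
      (∀ t, φ' t = Sum.elim (q' (T - t)) (-u' (T - t))) → X = signal (N₀ *ᵥ a') hφ' →
      inner ℝ X φ = a' ⬝ᵥ (Q₀⁻¹ *ᵥ a) + ∫ t in (0 : ℝ)..T,
        Sum.elim (q' t) (u' t) ⬝ᵥ (weight Q R *ᵥ Sum.elim (q t) (u t)) := by
    rintro a' q' u' w' - X φ' hφ' hφe rfl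
    rw [hφdef, inner_signal hT.le, hmm h1₀]
    congr 1
    have := intervalIntegral.integral_comp_sub_left (a := 0) (b := T) (fun t =>
      Sum.elim (q' t) (u' t) ⬝ᵥ (weight Q R *ᵥ Sum.elim (q t) (u t))) T
    rw [sub_self, sub_zero] at this
    rw [← this]
    refine intervalIntegral.integral_congr fun t _ => ?_
    simp only [hmm h1, hφe, dotProduct_weight_mulVec]
    change _ + (-u' (T - t)) ⬝ᵥ (R⁻¹ *ᵥ (-u (T - t))) = _
    rw [mulVec_neg, neg_dotProduct_neg]
  have hφφ : inner ℝ φ φ = J := by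
    rw [hdd a q u w hd φ _ (fun t => rfl) hφdef, hJ]
  have hle : worstCaseError F A H Q₀ Q R ℓ T (fun s => u (T - s)) ≤ (J : EReal) := by
    refine sSup_le ?_
    rintro _ ⟨x, f, y, η, z, hadm, rfl⟩
    rw [EReal.coe_le_coe_iff, herr hadm.sol]
    set X := signal (N₀' *ᵥ z 0) (memLp_mulVec (memLp_sumElim (l2Loc_Icc_iff.1 hadm.sol.dae.f_mem)
      (l2Loc_Icc_iff.1 hadm.sol.η_mem)) N') with hX
    have hXX : inner ℝ X X ≤ 1 := by
      rw [hrho hadm.sol X hX]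
      exact hadm.bound T ⟨hT.le, le_rfl⟩
    have hcs := real_inner_mul_inner_self_le φ X
    rw [hφφ] at hcs
    have hJ0 : 0 ≤ J := by rw [← hφφ]; exact real_inner_self_nonneg
    nlinarith
  -- The closure is the double orthogonal complement. A vector orthogonal to all zero-output
  -- disturbances is a dual solution with zero initial value, and `hopt` makes `φ` orthogonal to it.
  have hmem : φ ∈ (zeroOutputSignals F A H N₀' N' hT.le).topologicalClosure := by
    rw [← Submodule.orthogonal_orthogonal_eq_closure, Submodule.mem_orthogonal]
    intro X hX
    obtain ⟨b, ψ, hψ, rfl⟩ := exists_eq_signal X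
    -- Undoes the scaling: `N N'ᵀ = 1`, so `ψ'` is the unscaled dual signal with `N ψ' = ψ`.
    have hψ' := memLp_mulVec hψ N'ᵀ
    set ψ' := fun t => N'ᵀ *ᵥ ψ t with hψdef
    have hf : MemLp (fun t => ψ' t ∘ Sum.inl) 2 (volume.restrict (Icc 0 T)) :=
      memLp_comp_index hψ' _
    have hη : MemLp (fun t => ψ' t ∘ Sum.inr) 2 (volume.restrict (Icc 0 T)) :=
      memLp_comp_index hψ' _
    have hb : N₀ *ᵥ (N₀'ᵀ *ᵥ b) = b := by rw [mulVec_mulVec, h4₀, one_mulVec]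
    have hψN : ∀ t, N *ᵥ ψ' t = ψ t := fun t => by rw [hψdef, mulVec_mulVec, h4, one_mulVec]
    obtain ⟨w', hd', hw0, hwT⟩ := exists_isDualSolution_of_orthogonal (F := F) (A := A) (H := H)
      hT.le (a := N₀'ᵀ *ᵥ b) hf hη (by
        intro x f η z hsol
        have := (Submodule.mem_orthogonal' _ _).1 hX _ ⟨x, f, η, z, hsol, rfl⟩
        rw [inner_signal hT.le, ← hb, hpd h3₀] at this
        simp only [← hψN, hpd h3] at this
        refine Eq.trans ?_ this
        congr 1
        refine intervalIntegral.integral_congr fun t _ => ?_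
        rw [← sumElim_dotProduct_sumElim, Sum.elim_comp_inl_inr])
    have := hopt _ _ _ _ hd' hw0 hwT.symm
    rw [← hdd _ _ _ _ hd' (signal b hψ) (φ' := ψ') (memLp_mulVec hψ' N) ?_ ?_] at this
    · exact this
    · intro t
      simp only [sub_sub_cancel, neg_neg]
      rw [Sum.elim_comp_inl_inr]
    · exact signal_congr hb.symm _ _ (Filter.Eventually.of_forall fun t => (hψN t).symm)
  have hge : ∀ U : ℝ → Fin p → ℝ, (J : EReal) ≤ worstCaseError F A H Q₀ Q R ℓ T U := by
    intro U
    by_contra! hlt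
    -- A real `c` strictly between the two values bounds the squared errors on zero-output
    -- solutions. There the error does not depend on `U`, so `‖φ‖² ≤ c < J` contradicts `‖φ‖² = J`.
    obtain ⟨c, hUc, hcJ⟩ := EReal.lt_iff_exists_real_btwn.1 hlt
    rw [EReal.coe_lt_coe_iff] at hcJ
    refine absurd hcJ (not_lt.2 ?_)
    rw [← hφφ]
    refine inner_self_le_of_mem_closure _ hmem ?_
    rintro X ⟨x, f, η, z, hsol, hX⟩ hX1
    rw [hrho hsol X hX] at hX1
    have he := herr hsol
    rw [← hX] at he
    have hzero : ∀ V : ℝ → Fin p → ℝ, observerOutput V 0 T = 0 := fun V => by simp [observerOutput]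
    rw [← he, hzero, sub_zero, ← EReal.coe_le_coe_iff]
    refine le_trans (le_sSup ?_) hUc.le
    exact ⟨x, f, 0, η, z, isAdmissible_of_rho_le hQ hR hsol hX1, by rw [hzero, sub_zero]⟩
  exact ⟨le_antisymm hle (hge _), hge⟩

end Minimax

/-! ### Closed-loop solution of the dual equation and its optimality -/

section Associated

variable {m n p r k : ℕ} {S : LTI m p r k} {F A : Matrix (Fin m) (Fin n) ℝ}
  {H : Matrix (Fin p) (Fin n) ℝ} {Q₀ Q : Matrix (Fin m) (Fin m) ℝ} {R : Matrix (Fin p) (Fin p) ℝ}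
  {T : ℝ} {P : ℝ → Matrix (Fin r) (Fin r) ℝ}

theorem LTI.output_eq (S : LTI m p r k) (v : Fin r → ℝ) (g : Fin k → ℝ) :
    S.C *ᵥ v + S.D *ᵥ g = Sum.elim (S.Cs *ᵥ v + S.Ds *ᵥ g) (S.Cu *ᵥ v + S.Du *ᵥ g) := by
  ext (i | i) <;> rfl

/-- The continuous representative of `Fᵀ q` is determined by the state of an associated system. -/
theorem IsDualSolution.eq_state (hS : S.IsAssociated F A H) (hT : 0 < T) {q : ℝ → Fin m → ℝ}
    {u : ℝ → Fin p → ℝ} {w : ℝ → Fin n → ℝ} (hd : IsDualSolution F A H (Icc 0 T) q u w)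
    {v : ℝ → Fin r → ℝ} {g : ℝ → Fin k → ℝ} (hv : ACOn (Icc 0 T) v)
    (hq : ∀ᵐ t ∂volume.restrict (Icc 0 T), Sum.elim (q t) (u t) = S.C *ᵥ v t + S.D *ᵥ g t) :
    ∀ t ∈ Icc 0 T, w t = Fᵀ *ᵥ (S.Cs *ᵥ v t) := by
  have hvc : ContinuousOn v (Icc 0 T) := by
    simpa [uIcc_of_le hT.le] using ((acOn_Icc_iff hT.le).1 hv).continuousOn
  refine Measure.eqOn_Icc_of_ae_eq volume hT.ne ?_ (hd.dae.continuousOn hT.le)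
    (continuousOn_const.matrix_mulVec' (continuousOn_const.matrix_mulVec' hvc))
  filter_upwards [hd.dae.ae_eq, hq] with t h1 h2
  rw [S.output_eq, Sum.elim_eq_iff] at h2
  rw [h1, h2.1, mulVec_add, mulVec_mulVec _ Fᵀ S.Ds, hS.Ds_eq, zero_mulVec, add_zero]

/-- Every solution of the dual equation is an output of an associated system. -/
theorem IsDualSolution.exists_state (hS : S.IsAssociated F A H) (hT : 0 < T) {q : ℝ → Fin m → ℝ}
    {u : ℝ → Fin p → ℝ} {w : ℝ → Fin n → ℝ} (hd : IsDualSolution F A H (Icc 0 T) q u w) :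
    ∃ (v : ℝ → Fin r → ℝ) (g : ℝ → Fin k → ℝ), ACOn (Icc 0 T) v ∧
      (∀ᵐ t ∂volume.restrict (Icc 0 T), HasDerivAt v (S.A *ᵥ v t + S.B *ᵥ g t) t) ∧
      (∀ᵐ t ∂volume.restrict (Icc 0 T), Sum.elim (q t) (u t) = S.C *ᵥ v t + S.D *ᵥ g t) ∧
      (∀ t ∈ Icc 0 T, w t = Fᵀ *ᵥ (S.Cs *ᵥ v t)) ∧ v 0 = S.stateMap F *ᵥ w 0 := by
  obtain ⟨v, g, hv, -, hdv, hq⟩ := (hS.behavior _ (.inl ⟨T, hT, rfl⟩) q u).1 ⟨w, hd⟩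
  have hw := hd.eq_state hS hT hv hq
  refine ⟨v, g, hv, hdv, hq, hw, ?_⟩
  rw [hw 0 ⟨le_rfl, hT.le⟩, LTI.stateMap, mulVec_mulVec (v 0) Fᵀ, pinv_mulVec_of_rank_eq hS.rank_eq]

/-- The dual solution granted by impulse observability has a state at time `0`, which exhibits `Fᵀℓ`
in the range of `FᵀC_s`. Its interval `[0, τ]` need not be the horizon: only the initial value is
used, and the closed loop then exists on any horizon. -/
theorem IsImpulseObservable.mul_stateMap_mulVec (hS : S.IsAssociated F A H) {ℓ : Fin m → ℝ}
    (hℓ : IsImpulseObservable F A H ℓ) :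
    Fᵀ *ᵥ (S.Cs *ᵥ (S.stateMap F *ᵥ (Fᵀ *ᵥ ℓ))) = Fᵀ *ᵥ ℓ := by
  obtain ⟨τ, hτ, q, u, w, hd, hw⟩ := hℓ
  obtain ⟨v, g, -, -, -, h1, h2⟩ := hd.exists_state hS hτ
  rw [← hw, ← h2]
  exact (h1 0 ⟨le_rfl, hτ.le⟩).symm

/-- The closed loop yields a solution of the dual equation. -/
theorem IsClosedLoopState.exists_isDualSolution (hS : S.IsAssociated F A H) (hT : 0 < T)
    {ℓ : Fin m → ℝ} (hℓ : IsImpulseObservable F A H ℓ) (hP : IsRiccatiSolution S F Q₀ Q R T P)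
    {v : ℝ → Fin r → ℝ} (hv : IsClosedLoopState S F Q R ℓ T P v) :
    ∃ (q : ℝ → Fin m → ℝ) (w : ℝ → Fin n → ℝ),
      IsDualSolution F A H (Icc 0 T) q (optimalControl S Q R T P v) w ∧
      (∀ t, Sum.elim (q t) (optimalControl S Q R T P v t) =
        (S.C - S.D * gain S Q R (P (T - t))) *ᵥ v t) ∧
      w 0 = Fᵀ *ᵥ ℓ ∧ w T = Fᵀ *ᵥ (S.Cs *ᵥ v T) := by
  have hvac := (acOn_Icc_iff hT.le).1 hv.ac
  have hvc : ContinuousOn v (Icc 0 T) := by simpa [uIcc_of_le hT.le] using hvac.continuousOn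
  have hK := continuousOn_comp_sub_left
    (continuousOn_gain (S := S) (Q := Q) (R := R) hP.continuousOn)
  -- Closing the loop with the input `-K v` makes the closed-loop trajectory one of the open-loop
  -- system, to which the behavior equivalence applies.
  set g : ℝ → Fin k → ℝ := fun s => -(gain S Q R (P (T - s)) *ᵥ v s) with hg
  set q : ℝ → Fin m → ℝ := fun s => (S.Cs - S.Ds * gain S Q R (P (T - s))) *ᵥ v s with hq
  have hout : ∀ t, Sum.elim (q t) (optimalControl S Q R T P v t) = S.C *ᵥ v t + S.D *ᵥ g t := by
    intro t
    rw [S.output_eq, hg, hq, optimalControl]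
    simp only [add_mulVec, neg_mulVec, mulVec_neg, mulVec_mulVec, sub_eq_add_neg]
  obtain ⟨w, hw⟩ := (hS.behavior _ (.inl ⟨T, hT, rfl⟩) q (optimalControl S Q R T P v)).2
    ⟨v, g, hv.ac, l2Loc_Icc_iff.2 ((hK.matrix_mulVec' hvc).neg.memLp_Icc 2), by
      filter_upwards [hv.deriv] with s hs
      refine hs.congr_deriv ?_
      simp only [hg, add_mulVec, neg_mulVec, mulVec_neg, mulVec_mulVec, sub_eq_add_neg],
      Filter.Eventually.of_forall hout⟩
  have hws := hw.eq_state hS hT hv.ac (Filter.Eventually.of_forall hout)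
  refine ⟨q, w, hw, fun t => ?_, ?_, hws T ⟨hT.le, le_rfl⟩⟩
  · rw [hout]
    simp only [hg, add_mulVec, neg_mulVec, mulVec_neg, mulVec_mulVec, sub_eq_add_neg]
  · rw [hws 0 ⟨le_rfl, hT.le⟩, hv.init, hℓ.mul_stateMap_mulVec hS]

/-- The bilinear dual cost of a solution of the dual equation and the closed-loop solution. -/
theorem IsRiccatiSolution.dual_cost (hS : S.IsAssociated F A H) (hQ₀ : Q₀.PosDef) (hQ : Q.PosDef)
    (hR : R.PosDef) (hT : 0 < T) {ℓ : Fin m → ℝ} (hP : IsRiccatiSolution S F Q₀ Q R T P)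
    {v' : ℝ → Fin r → ℝ} (hv' : IsClosedLoopState S F Q R ℓ T P v') {q : ℝ → Fin m → ℝ}
    {u : ℝ → Fin p → ℝ} {w : ℝ → Fin n → ℝ} (hd : IsDualSolution F A H (Icc 0 T) q u w)
    {a : Fin m → ℝ} (ha : Fᵀ *ᵥ a = w T) :
    a ⬝ᵥ (Q₀⁻¹ *ᵥ ((pinv Fᵀ - Mopt F Q₀) *ᵥ (Fᵀ *ᵥ (S.Cs *ᵥ v' T)))) +
      ∫ t in (0 : ℝ)..T, Sum.elim (q t) (u t) ⬝ᵥ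
        (weight Q R *ᵥ ((S.C - S.D * gain S Q R (P (T - t))) *ᵥ v' t)) =
      (S.stateMap F *ᵥ w 0) ⬝ᵥ (P T *ᵥ v' 0) := by
  obtain ⟨v, g, hv, hdv, hq, hw, hv0⟩ := hd.exists_state hS hT
  have key := hP.integral_cost hQ₀ hQ hR hS.input hT.le ((acOn_Icc_iff hT.le).1 hv)
    ((acOn_Icc_iff hT.le).1 hv'.ac) hdv hv'.deriv
  have hint : ∫ t in (0 : ℝ)..T, Sum.elim (q t) (u t) ⬝ᵥ
      (weight Q R *ᵥ ((S.C - S.D * gain S Q R (P (T - t))) *ᵥ v' t)) = _ :=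
    (intervalIntegral_congr_ae_Icc ⟨hT.le, le_rfl⟩
      (by filter_upwards [hq] with t ht; rw [ht])).trans key
  have hP0 : v T ⬝ᵥ (P 0 *ᵥ v' T) = (S.Cs *ᵥ v T) ⬝ᵥ (Qbar F Q₀ *ᵥ (S.Cs *ᵥ v' T)) := by
    rw [hP.init, mulVec_dotProduct_eq]
    simp only [mulVec_mulVec, Matrix.mul_assoc]
  -- `a` and `C_s v(T)` have the same image under `Fᵀ`, so the first term is the `Qbar` form at `C_s
  -- v(T)`. This cancels the terminal term of the integral, which carries `P 0`.
  rw [hint, dotProduct_inv_pinv_sub_Mopt hQ₀ a (S.Cs *ᵥ v T) _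
    (by rw [ha, hw T ⟨hT.le, le_rfl⟩]), hP0, ← hv0]
  ring

/-- `IsRiccatiSolution.dual_cost` serves twice: against the closed-loop solution itself it gives the
value, and against dual solutions with `w 0 = 0` it gives stationarity, because its right-hand side
depends on the other solution only through `w 0`. -/
theorem isMinimaxObserver_optimalControl (hS : S.IsAssociated F A H) (hQ₀ : Q₀.PosDef)
    (hQ : Q.PosDef) (hR : R.PosDef) (hT : 0 < T) {ℓ : Fin m → ℝ}
    (hℓ : IsImpulseObservable F A H ℓ) (hP : IsRiccatiSolution S F Q₀ Q R T P)
    {v : ℝ → Fin r → ℝ} (hv : IsClosedLoopState S F Q R ℓ T P v) :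
    IsMinimaxObserver F A H Q₀ Q R ℓ T (fun s => optimalControl S Q R T P v (T - s)) ∧
    worstCaseError F A H Q₀ Q R ℓ T (fun s => optimalControl S Q R T P v (T - s)) =
      ((ℓ ⬝ᵥ ((F * (S.stateMap F)ᵀ * P T * S.stateMap F * Fᵀ) *ᵥ ℓ) : ℝ) : EReal) := by
  obtain ⟨q, w, hd, hout, hw0, hwT⟩ := hv.exists_isDualSolution hS hT hℓ hP
  have hcost : (S.stateMap F *ᵥ (Fᵀ *ᵥ ℓ)) ⬝ᵥ (P T *ᵥ v 0) =
      ℓ ⬝ᵥ ((F * (S.stateMap F)ᵀ * P T * S.stateMap F * Fᵀ) *ᵥ ℓ) := by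
    rw [hv.init, mulVec_dotProduct_eq, mulVec_dotProduct_eq, transpose_transpose]
    simp only [mulVec_mulVec, Matrix.mul_assoc]
  have ha : Fᵀ *ᵥ ((pinv Fᵀ - Mopt F Q₀) *ᵥ (Fᵀ *ᵥ (S.Cs *ᵥ v T))) = w T := by
    rw [transpose_mulVec_pinv_sub_Mopt, hwT]
  obtain ⟨heq, hge⟩ := worstCaseError_of_dual_optimal hT hQ₀ hQ hR hd hw0 ha
    (J := ℓ ⬝ᵥ ((F * (S.stateMap F)ᵀ * P T * S.stateMap F * Fᵀ) *ᵥ ℓ))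
    (by
      have := hP.dual_cost hS hQ₀ hQ hR hT hv hd ha
      simp only [← hout] at this
      rw [this, hw0, hcost])
    (by
      intro a' q' u' w' hd' hw' ha'
      have := hP.dual_cost hS hQ₀ hQ hR hT hv hd' ha'
      simp only [← hout] at this
      rw [this, hw', mulVec_zero, zero_dotProduct])
  have hU : L2Loc (Icc 0 T) (fun s => optimalControl S Q R T P v (T - s)) :=
    l2Loc_Icc_iff.2 (memLp_comp_sub_left (l2Loc_Icc_iff.1 hd.u_mem))
  refine ⟨⟨hU, le_antisymm (le_sInf ?_) (sInf_le ⟨_, hU, rfl⟩), ?_⟩, heq⟩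
  · rintro _ ⟨V, -, rfl⟩
    rw [heq]
    exact hge V
  · rw [heq]
    exact EReal.coe_lt_top _

end Associated

theorem theorem3 {m n p d k : ℕ}
    (F A : Matrix (Fin m) (Fin n) ℝ) (H : Matrix (Fin p) (Fin n) ℝ)
    (Q₀ Q : Matrix (Fin m) (Fin m) ℝ) (R : Matrix (Fin p) (Fin p) ℝ)
    (hQ₀ : Q₀.PosDef) (hQ : Q.PosDef) (hR : R.PosDef)
    (S : LTI m p d k) (hS : S.IsAssociated F A H)
    (ℓ : Fin m → ℝ) (hℓ : IsImpulseObservable F A H ℓ)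
    (t₁ : ℝ) (ht₁ : 0 < t₁) :
    (∃ P : ℝ → Matrix (Fin d) (Fin d) ℝ, IsRiccatiSolution S F Q₀ Q R t₁ P) ∧
    ∀ P : ℝ → Matrix (Fin d) (Fin d) ℝ, IsRiccatiSolution S F Q₀ Q R t₁ P →
      (∃ v : ℝ → Fin d → ℝ, IsClosedLoopState S F Q R ℓ t₁ P v) ∧
      ∀ v : ℝ → Fin d → ℝ, IsClosedLoopState S F Q R ℓ t₁ P v →
        IsMinimaxObserver F A H Q₀ Q R ℓ t₁ (fun s => optimalControl S Q R t₁ P v (t₁ - s)) ∧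
        worstCaseError F A H Q₀ Q R ℓ t₁ (fun s => optimalControl S Q R t₁ P v (t₁ - s)) =
          ((ℓ ⬝ᵥ ((F * (S.stateMap F)ᵀ * P t₁ * S.stateMap F * Fᵀ) *ᵥ ℓ) : ℝ) : EReal) ∧
        ∀ y : ℝ → Fin p → ℝ, L2Loc (Icc 0 t₁) y →
          (∃ r : ℝ → Fin d → ℝ, IsObserverState S Q R t₁ P y r) ∧
          ∀ r : ℝ → Fin d → ℝ, IsObserverState S Q R t₁ P y r →
            observerOutput (fun s => optimalControl S Q R t₁ P v (t₁ - s)) y t₁ =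
              ℓ ⬝ᵥ ((F * (S.stateMap F)ᵀ) *ᵥ r t₁) := by
  refine ⟨exists_isRiccatiSolution S F hQ₀ hQ hR hS.input ht₁.le, fun P hP =>
    ⟨exists_isClosedLoopState ht₁.le ℓ hP, fun v hv => ?_⟩⟩
  obtain ⟨hmin, hval⟩ := isMinimaxObserver_optimalControl hS hQ₀ hQ hR ht₁ hℓ hP hv
  exact ⟨hmin, hval, fun y hy => ⟨exists_isObserverState ht₁.le hP hy, fun r hr =>
    observerOutput_eq ht₁.le hv hr⟩⟩
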